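/- Let $d>0$ and let $c=(c_1,0,c_2):[-d,d]\to\mathbb R^3$ be a smooth curve such that $c_1>0$ and $\dot c_2>0$ on $I_d:=(-d,d)$, $c_1(\pm d)=0$, $\dot c_1^2+\dot c_2^2=1$, $\dot c_1(-d)=1$, $\dot c_1(d)=-1$, and $c_1^{(2n)}(\pm d)=0$ for all integers $n\ge 1$. Let $$R'(c)=\{(c_1(r)\cos\theta,\,c_1(r)\sin\theta,\,c_2(r)) : r\in I_d,\ \theta\in\mathbb R\}\subset\mathbb R^3,$$ and let $M=R(c)$ be the closure of $R'(c)$, a closed surface obtained by adding the two poles $c(\pm d)$, with the smooth structure given by the polar coordinates $(d\pm r,\theta)$ around the poles and with the Riemannian metric $g$ induced from $\mathbb R^3$, so that $g=dr^2+c_1(r)^2d\theta^2$ on $R'(c)$. Let $\mu$ be the Riemannian volume and $\nabla$ the Levi-Civita connection of $g$, and for $s>3$ let $T_e\mathcal D^s_\mu(M)$ be the space of divergence-free vector fields of Sobolev class $H^s$ on $M$. For $V,W\in T_e\mathcal D^s_\mu(M)$ define the Misiołek curvature $$MC_{V,W}=\int_M g\big(\nabla_V[V,W]+\nabla_{[V,W]}V,\;W\big)\,\mu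 .$$ Suppose that $s>3$ and that $$(\partial_r c_1)^2-c_1\,\partial_r^2c_1>1\quad\text{on } I_d .$$ Let $V\in T_e\mathcal D^s_\mu(M)$ be a zonal flow, i.e. $V=F(r)\,\partial_\theta$ on $R'(c)$ for some function $F:I_d\to\mathbb R$, such that $V$ is not identically zero and the support of $V$ is contained in $R'(c)$. Then there is a smooth function $h$ with compact support in $I_d$, satisfying $h\neq0$ and $\partial_rh=0$ on the support of $F$, such that the vector field $$W_0=h(r)\sin\theta\,\partial_r+\Big(\partial_rh(r)+\frac{h(r)\,\partial_rc_1(r)}{c_1(r)}\Big)\cos\theta\,\partial_\theta ,$$ extended by zero to the poles, belongs to $T_e\mathcal D^s_\mu(M)$ and satisfies $MC_{V,W_0}>0$. -/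

import Mathlib

open Set Metric MeasureTheory
open scoped ContDiff SchwartzMap

noncomputable section

/-- The coordinate plane. -/
abbrev E2 : Type := EuclideanSpace ℝ (Fin 2)

/-- The ambient Euclidean space `ℝ³`. -/
abbrev E3 : Type := EuclideanSpace ℝ (Fin 3)

/-! ## Calculus in a local parametrization

`Ψ : E2 → E3` is a local parametrization of a surface in `ℝ³` (an immersion on its domain), and the
surface carries the metric induced from `ℝ³`. -/

namespace LocalParam

/-- The coordinate vectors of `ℝ²`. -/
def e (i : Fin 2) : E2 := EuclideanSpace.single i 1

/-- The partial derivative `∂ᵢ f` of a scalar function of the coordinates. -/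
def pd (i : Fin 2) (f : E2 → ℝ) (x : E2) : ℝ := fderiv ℝ f x (e i)

/-- The coordinate vector field `Ψ_* ∂ᵢ`, as a vector of `ℝ³`. -/
def frame (Ψ : E2 → E3) (i : Fin 2) (x : E2) : E3 := fderiv ℝ Ψ x (e i)

/-- The matrix `g_{ij}` of the metric induced from `ℝ³`. -/
def gram (Ψ : E2 → E3) (x : E2) : Matrix (Fin 2) (Fin 2) ℝ :=
  Matrix.of fun i j => inner ℝ (frame Ψ i x) (frame Ψ j x)

/-- The density `√(det g)` of the Riemannian volume `μ`. -/
def density (Ψ : E2 → E3) (x : E2) : ℝ := Real.sqrt (gram Ψ x).det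

/-- The metric applied to two coordinate vectors. -/
def metric (Ψ : E2 → E3) (x v w : E2) : ℝ := ∑ i, ∑ j, gram Ψ x i j * v i * w j

/-- The Christoffel symbol `Γᵏᵢⱼ` of the Levi-Civita connection. -/
def christoffel (Ψ : E2 → E3) (k i j : Fin 2) (x : E2) : ℝ :=
  (1 / 2) * ∑ l, (gram Ψ x)⁻¹ k l *
    (pd i (fun y => gram Ψ y j l) x + pd j (fun y => gram Ψ y i l) x
      - pd l (fun y => gram Ψ y i j) x)

/-- The Levi-Civita covariant derivative `∇_v w` of coordinate vector fields. -/
def nabla (Ψ : E2 → E3) (v w : E2 → E2) (x : E2) : E2 :=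
  WithLp.toLp 2 fun k =>
    fderiv ℝ (fun y => w y k) x (v x) + ∑ i, ∑ j, christoffel Ψ k i j x * v x i * w x j

/-- The divergence `(det g)^{-1/2} ∂ᵢ((det g)^{1/2} vⁱ)` of a coordinate vector field. -/
def divergence (Ψ : E2 → E3) (v : E2 → E2) (x : E2) : ℝ :=
  (density Ψ x)⁻¹ * ∑ i, pd i (fun y => density Ψ y * v y i) x

/-- The components in the parametrization `Ψ` of a field `V` of vectors of `ℝ³`:
`coords Ψ V x` is the `v` with `DΨ(x) v = V (Ψ x)`. It is unique where `Ψ` is an immersion, and it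
exists if `V` is tangent to the surface at `Ψ x`. -/
def coords (Ψ : E2 → E3) (V : E3 → E3) (x : E2) : E2 :=
  Function.invFun (fderiv ℝ Ψ x) (V (Ψ x))

/-- The integrand `g(∇_V [V, W] + ∇_{[V, W]} V, W)`, in coordinates. -/
def misiolekIntegrand (Ψ : E2 → E3) (V W : E3 → E3) (x : E2) : ℝ :=
  let v := coords Ψ V
  let w := coords Ψ W
  let b := VectorField.lieBracket ℝ v w
  metric Ψ x (nabla Ψ v b x + nabla Ψ b v x) (w x)

end LocalParam

/-- `f ∈ H^s(ℝ²)` for a real valued function `f` and a real order `s`. -/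
def IsSobolev (s : ℝ) (f : E2 → ℝ) : Prop :=
  ∃ hf : MemLp (fun x => (f x : ℂ)) 2 (volume : Measure E2),
    TemperedDistribution.MemSobolev s 2 (hf.toLp _ : 𝓢'(E2, ℂ))

/-- `f ∈ H^s_loc(U)`: every product with a smooth cutoff compactly supported in `U` is in
`H^s(ℝ²)`. -/
def IsSobolevLoc (s : ℝ) (U : Set E2) (f : E2 → ℝ) : Prop :=
  ∀ χ : E2 → ℝ, ContDiff ℝ ∞ χ → HasCompactSupport χ → tsupport χ ⊆ U →
    IsSobolev s (fun x => χ x * f x)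

/-- A profile curve `c = (c₁, 0, c₂) : [-d, d] → ℝ³`, smooth on the closed interval, parametrized by
arc length, with the conditions at the end points that make the surface obtained by rotating it
around the `z`-axis a smooth closed Riemannian surface. -/
structure ProfileCurve where
  d : ℝ
  c₁ : ℝ → ℝ
  c₂ : ℝ → ℝ
  d_pos : 0 < d
  smooth₁ : ContDiffOn ℝ ∞ c₁ (Icc (-d) d)
  smooth₂ : ContDiffOn ℝ ∞ c₂ (Icc (-d) d)
  pos : ∀ r ∈ Ioo (-d) d, 0 < c₁ r
  zero_left : c₁ (-d) = 0
  zero_right : c₁ d = 0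
  increasing : ∀ r ∈ Ioo (-d) d, 0 < deriv c₂ r
  arclength : ∀ r ∈ Ioo (-d) d, deriv c₁ r ^ 2 + deriv c₂ r ^ 2 = 1
  deriv_left : derivWithin c₁ (Icc (-d) d) (-d) = 1
  deriv_right : derivWithin c₁ (Icc (-d) d) d = -1
  even_left : ∀ n : ℕ, 0 < n → iteratedDerivWithin (2 * n) c₁ (Icc (-d) d) (-d) = 0
  even_right : ∀ n : ℕ, 0 < n → iteratedDerivWithin (2 * n) c₁ (Icc (-d) d) d = 0

namespace ProfileCurve

open LocalParam

/-- The parametrization `φ(r, θ) = (c₁(r) cos θ, c₁(r) sin θ, c₂(r))`. -/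
def param (c : ProfileCurve) (x : E2) : E3 :=
  !₂[c.c₁ (x 0) * Real.cos (x 1), c.c₁ (x 0) * Real.sin (x 1), c.c₂ (x 0)]

/-- The surface of revolution `R'(c)`, without the poles. -/
def openSurface (c : ProfileCurve) : Set E3 :=
  {p | ∃ r ∈ Ioo (-c.d) c.d, ∃ θ : ℝ, p = c.param !₂[r, θ]}

/-- The closed surface `R(c)`, the closure of `R'(c)`. -/
def surface (c : ProfileCurve) : Set E3 := closure c.openSurface

/-- The chart of `R(c)` around the pole `c(-d)`: the point with polar coordinates `(t, θ)` in the
disc of radius `2d` goes to `φ(t - d, θ)`, and the centre goes to the pole. -/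
def southChart (c : ProfileCurve) (x : E2) : E3 :=
  !₂[c.c₁ (‖x‖ - c.d) * (x 0 / ‖x‖), c.c₁ (‖x‖ - c.d) * (x 1 / ‖x‖), c.c₂ (‖x‖ - c.d)]

/-- The chart of `R(c)` around the pole `c(d)`: the point with polar coordinates `(t, θ)` in the
disc of radius `2d` goes to `φ(d - t, θ)`, and the centre goes to the pole. -/
def northChart (c : ProfileCurve) (x : E2) : E3 :=
  !₂[c.c₁ (c.d - ‖x‖) * (x 0 / ‖x‖), c.c₁ (c.d - ‖x‖) * (x 1 / ‖x‖), c.c₂ (c.d - ‖x‖)]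

/-- The vector field `V` (of which only the values on `R(c)` matter) is, in the chart `Ψ` defined on
the disc of radius `2d`, tangent to the surface, continuous, and of class `H^s_loc`. -/
def SobolevInChart (c : ProfileCurve) (s : ℝ) (Ψ : E2 → E3) (V : E3 → E3) : Prop :=
  (∀ x ∈ ball (0 : E2) (2 * c.d), V (Ψ x) ∈ range (fderiv ℝ Ψ x)) ∧
  ContinuousOn (coords Ψ V) (ball 0 (2 * c.d)) ∧
  ∀ i, IsSobolevLoc s (ball 0 (2 * c.d)) (fun x => coords Ψ V x i)

/-- The space `T_e D^s_μ(R(c))` of divergence-free vector fields of class `H^s` on `R(c)`. The two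
discs cover `R(c)`. A field of class `H^s` with `s > 1` is identified with its continuous
representative; for `s > 2` it is of class `C¹`, and its divergence, being continuous, vanishes on
`R(c)` as soon as it vanishes on the dense part `R'(c)`. -/
def divFreeFields (c : ProfileCurve) (s : ℝ) : Set (E3 → E3) :=
  {V | c.SobolevInChart s c.southChart V ∧ c.SobolevInChart s c.northChart V ∧
    ∀ x : E2, x 0 ∈ Ioo (-c.d) c.d → divergence c.param (coords c.param V) x = 0}

/-- `V` is the zonal flow `F(r) ∂_θ`. -/
def IsZonalFlow (c : ProfileCurve) (F : ℝ → ℝ) (V : E3 → E3) : Prop :=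
  ∀ r ∈ Ioo (-c.d) c.d, ∀ θ : ℝ, V (c.param !₂[r, θ]) = F r • frame c.param 1 !₂[r, θ]

/-- The Misiołek curvature `MC_{V,W} = (∇_V [V, W] + ∇_{[V, W]} V, W)`, where `( , )` is the
`L²` inner product `∫_M g( , ) μ`. The integral over `M = R(c)` is computed in the coordinates
`(r, θ)`, which cover `R(c)` up to a null set. -/
def misiolekCurvature (c : ProfileCurve) (V W : E3 → E3) : ℝ :=
  ∫ x in {x : E2 | x 0 ∈ Ioo (-c.d) c.d ∧ x 1 ∈ Ioo (-Real.pi) Real.pi},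
    misiolekIntegrand c.param V W x * density c.param x

end ProfileCurve

end

/-! Choose `h` to be a bump function equal to `1` near the support of `F`. Since the bracket and the
connection are local and the integrand vanishes where `V` vanishes near the point, the perturbation
may be replaced by `sin θ ∂_r + (c₁'/c₁) cos θ ∂_θ`. With the volume density `c₁`, the integrand is
then `A(r) sin² θ + B(r) cos² θ`. Both squares integrate to `π`, so the curvature is `π ∫ (A + B)
dr`, where `A + B = c₁ (-F² + 3 c₁'² F² + 2 c₁ c₁' F F')`. Subtracting the derivative of `H = c₁²
c₁' F²`, which is zero at the ends of an interval containing the support, leaves `c₁ F² (c₁'² - c₁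
c₁'' - 1)`. By hypothesis this is nonnegative, and it is positive wherever `F ≠ 0`. The computation
is `misiolekIntegrand_zonal`, the integration by parts `integral_coeff_pos`.

Two analytic points remain. The bracket contains `F'` and is differentiated once more, so `F` has to
be twice differentiable: this comes from the embedding of `H^s` into `C²` for `s > 3`
(`IsSobolev.ae_eq_contDiff`), read along a meridian in a polar chart. The perturbation must also be
an `H^s` field across the poles: in the polar charts it is smooth because it vanishes near the
centre (`contDiff_perturbationPolar`). At the centre itself the coordinates are meaningful because
the chart is an immersion there (`hasFDerivAt_polarChart_zero`). -/

/-! ### Sobolev embedding in the plane. -/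

section Sobolev

open FourierTransform TemperedDistribution

/-- The kernel of the inverse Fourier transform is symmetric, so Fubini moves the transform across.
This allows a distributional inverse transform to be identified with a pointwise one. -/
theorem integral_fourierInv_smul_eq_of_integrable {f g : E2 → ℂ} (hf : Integrable f)
    (hg : Integrable g) : ∫ x, 𝓕⁻ f x • g x = ∫ x, f x • 𝓕⁻ g x := by
  have := VectorFourier.integral_fourierIntegral_smul_eq_flip (μ := (volume : Measure E2))
    (ν := (volume : Measure E2)) (e := Real.fourierChar) (L := -innerₗ E2)
    Real.continuous_fourierChar continuous_inner.neg hf hg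
  have hflip : (-innerₗ E2).flip = -innerₗ E2 := by
    ext x y
    simp [real_inner_comm]
  rw [hflip] at this
  exact this

theorem contDiff_fourierInv {f : E2 → ℂ} {N : ℕ∞}
    (hf : ∀ n : ℕ, n ≤ N → Integrable (fun v ↦ ‖v‖ ^ n * ‖f v‖)) :
    ContDiff ℝ N (𝓕⁻ f) := by
  have h : 𝓕⁻ f = fun x => 𝓕 f (-x) := by
    ext x
    exact Real.fourierInv_eq_fourier_neg f x
  rw [h]
  exact (Real.contDiff_fourier hf).comp contDiff_neg

/-- The Sobolev embedding `H^s(ℝ²) ⊆ C²` for `s > 3`. -/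
theorem IsSobolev.ae_eq_contDiff {s : ℝ} (hs : 3 < s) {f : E2 → ℝ} (hf : IsSobolev s f) :
    ∃ g : E2 → ℝ, ContDiff ℝ 2 g ∧ f =ᵐ[volume] g := by
  obtain ⟨hfL, hfS⟩ := hf
  obtain ⟨u, hu⟩ := memSobolev_iff_exists_smulLeftCLM_fourier.mp hfS
  set w : E2 → ℂ := fun x => (((1 + ‖x‖ ^ 2) ^ (-(s / 2)) : ℝ) : ℂ) * u x with hw
  have hu2 : MemLp u 2 (volume : Measure E2) := Lp.memLp u
  have hcont : ∀ a : ℝ, Continuous fun x : E2 => (1 + ‖x‖ ^ 2) ^ a := fun a =>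
    Continuous.rpow_const (by fun_prop) fun x => Or.inl (by positivity)
  -- The square of this weight is integrable on the plane when `2s - 4 > 2`; this is where `s > 3`
  -- enters. By Cauchy–Schwarz with `u ∈ L²`, `w` then has integrable moments up to order 2.
  have hweight : MemLp (fun x : E2 => (1 + ‖x‖ ^ 2) ^ (1 - s / 2)) 2 volume := by
    rw [memLp_two_iff_integrable_sq (hcont _).aestronglyMeasurable]
    have := integrable_rpow_neg_one_add_norm_sq (E := E2) (μ := volume) (r := 2 * s - 4)
      (by simp; linarith)
    refine this.congr (ae_of_all _ fun x => ?_)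
    simp only
    rw [← Real.rpow_mul_natCast (by positivity)]
    congr 1
    push_cast
    ring
  have hmaj : Integrable (fun x : E2 => (1 + ‖x‖ ^ 2) ^ (1 - s / 2) * ‖u x‖) :=
    hweight.integrable_mul hu2.norm
  have hwmeas : AEStronglyMeasurable w volume :=
    (Complex.continuous_ofReal.comp (hcont _)).aestronglyMeasurable.mul hu2.1
  have hwint : ∀ n : ℕ, n ≤ 2 → Integrable (fun x : E2 => ‖x‖ ^ n * ‖w x‖) := by
    intro n hn
    refine hmaj.mono' ((continuous_norm.pow n).aestronglyMeasurable.mul hwmeas.norm)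
      (ae_of_all _ fun x => ?_)
    rw [Real.norm_of_nonneg (by positivity), hw]
    simp only [norm_mul, Complex.norm_real]
    rw [Real.norm_of_nonneg (by positivity), ← mul_assoc, sub_eq_add_neg,
      Real.rpow_add (by positivity), Real.rpow_one]
    gcongr
    interval_cases n <;> nlinarith [sq_nonneg (‖x‖ - 1), norm_nonneg x]
  have hwI : Integrable w := by
    have := hwint 0 (by norm_num)
    simpa [integrable_norm_iff hwmeas] using this
  have hC2 : ContDiff ℝ 2 (𝓕⁻ w) :=
    contDiff_fourierInv (N := 2) fun n hn => hwint n (by exact_mod_cast hn)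
  refine ⟨fun x => (𝓕⁻ w x).re, Complex.reCLM.contDiff.comp hC2, ?_⟩
  have hf2 : MemLp (fun x => (f x : ℂ)) 2 (volume : Measure E2) := hfL
  -- The hypothesis identifies `f` only as a tempered distribution, so the equality is tested
  -- against smooth compactly supported functions.
  have key : ∀ᵐ x : E2, (f x : ℂ) = 𝓕⁻ w x := by
    refine ae_eq_of_integral_contDiff_smul_eq (hf2.locallyIntegrable (by norm_num))
      hC2.continuous.locallyIntegrable fun φ hφ hφc => ?_
    have hφc' : HasCompactSupport fun x => (φ x : ℂ) := hφc.comp_left Complex.ofReal_zero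
    let Φ : 𝓢(E2, ℂ) := hφc'.toSchwartzMap (Complex.ofRealCLM.contDiff.comp hφ)
    have e0 : (hfL.toLp _ : 𝓢'(E2, ℂ)) =
        𝓕⁻ (smulLeftCLM ℂ (fun x : E2 => (((1 + ‖x‖ ^ 2) ^ (-(s / 2)) : ℝ) : ℂ))
          (u : 𝓢'(E2, ℂ))) := by
      rw [← hu, smulLeftCLM_smulLeftCLM_apply (by fun_prop) (by fun_prop)]
      have : ((fun x : E2 => (((1 + ‖x‖ ^ 2) ^ (-(s / 2)) : ℝ) : ℂ)) *
          fun x : E2 => (((1 + ‖x‖ ^ 2) ^ (s / 2) : ℝ) : ℂ)) = fun _ => 1 := by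
        ext x
        rw [Pi.mul_apply]
        norm_cast
        rw [← Real.rpow_add (by positivity)]
        simp
      rw [mul_comm, this]
      simp
    have e1 := congrArg (fun T : 𝓢'(E2, ℂ) => T Φ) e0
    simp only [Lp.toTemperedDistribution_apply] at e1
    have e2 : ∫ x, Φ x • (hfL.toLp _ : Lp ℂ 2 (volume : Measure E2)) x
        = ∫ x, φ x • (f x : ℂ) := by
      refine integral_congr_ae ?_
      filter_upwards [hfL.coeFn_toLp] with x hx
      rw [hx]
      rfl
    have e3 : (𝓕⁻ (smulLeftCLM ℂ (fun x : E2 => (((1 + ‖x‖ ^ 2) ^ (-(s / 2)) : ℝ) : ℂ))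
          (u : 𝓢'(E2, ℂ))) : 𝓢'(E2, ℂ)) Φ = ∫ x, 𝓕⁻ (Φ : E2 → ℂ) x • w x := by
      rw [fourierInv_apply, smulLeftCLM_apply_apply, Lp.toTemperedDistribution_apply]
      refine integral_congr_ae (ae_of_all _ fun x => ?_)
      simp only
      rw [SchwartzMap.smulLeftCLM_apply_apply (by fun_prop), SchwartzMap.fourierInv_coe]
      simp only [hw, smul_eq_mul]
      ring
    rw [e2, e3, integral_fourierInv_smul_eq_of_integrable Φ.integrable hwI] at e1
    rw [e1]
    rfl
  filter_upwards [key] with x hx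
  rw [← hx, Complex.ofReal_re]

theorem IsSobolev.of_contDiff {s : ℝ} {f : E2 → ℝ} (hf : ContDiff ℝ ∞ f)
    (hc : HasCompactSupport f) : IsSobolev s f := by
  have hc' : HasCompactSupport fun x => (f x : ℂ) := hc.comp_left Complex.ofReal_zero
  let Φ : 𝓢(E2, ℂ) := hc'.toSchwartzMap (Complex.ofRealCLM.contDiff.comp hf)
  refine ⟨Φ.memLp 2 volume, ?_⟩
  have := SchwartzMap.memSobolev (s := s) (p := 2) Φ
  rwa [← Lp.toTemperedDistribution_toLp_eq (p := 2)] at this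

/-- A continuous function of class `H^s_loc`, `s > 3`, on an open set of the plane is `C²`. -/
theorem IsSobolevLoc.contDiffOn {s : ℝ} (hs : 3 < s) {U : Set E2} (hU : IsOpen U) {f : E2 → ℝ}
    (hc : ContinuousOn f U) (hf : IsSobolevLoc s U f) : ContDiffOn ℝ 2 f U := by
  intro x hx
  obtain ⟨ε, hε, hball⟩ := Metric.isOpen_iff.mp hU x hx
  let χ : ContDiffBump x := ⟨ε / 4, ε / 2, by positivity, by linarith⟩
  have hsub : tsupport χ ⊆ U := by
    rw [χ.tsupport_eq]
    exact (closedBall_subset_ball (by simp only [χ]; linarith)).trans hball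
  obtain ⟨g, hg, hfg⟩ := (hf χ χ.contDiff χ.hasCompactSupport hsub).ae_eq_contDiff hs
  have hcont : Continuous fun y => χ y * f y := by
    refine continuous_iff_continuousAt.mpr fun y => ?_
    by_cases hy : y ∈ tsupport χ
    · exact χ.continuous.continuousAt.mul (hc.continuousAt (hU.mem_nhds (hsub hy)))
    · have : (fun y => χ y * f y) =ᶠ[nhds y] fun _ => 0 := by
        filter_upwards [notMem_tsupport_iff_eventuallyEq.mp hy] with z hz
        simp [hz]
      exact continuousAt_const.congr this.symm
  -- Continuity upgrades the almost everywhere equality to equality everywhere.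
  have heq := (hcont.ae_eq_iff_eq volume hg.continuous).mp hfg
  have : f =ᶠ[nhds x] g := by
    filter_upwards [χ.eventuallyEq_one] with y hy
    rw [← heq]
    simp [hy]
  exact (hg.contDiffAt.congr_of_eventuallyEq this).contDiffWithinAt

end Sobolev

/-! ### Coordinate calculus in the plane. -/

namespace LocalParam

open Filter Topology

theorem vec2_ext {v w : E2} (h0 : v 0 = w 0) (h1 : v 1 = w 1) : v = w := by
  ext i
  fin_cases i <;> assumption

theorem vec2_eta (x : E2) : x = !₂[x 0, x 1] := vec2_ext rfl rfl

theorem fderiv_apply_eq_frame (Ψ : E2 → E3) (x v : E2) :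
    fderiv ℝ Ψ x v = v 0 • frame Ψ 0 x + v 1 • frame Ψ 1 x := by
  have hv : v = v 0 • e 0 + v 1 • e 1 := vec2_ext (by simp [e]) (by simp [e])
  conv_lhs => rw [hv]
  simp only [map_add, map_smul, frame]

/-- `coords` is defined by `Function.invFun`, so injectivity of the differential is what pins down
its value. -/
theorem coords_eq_of_fderiv {Ψ : E2 → E3} {V : E3 → E3} {x v : E2}
    (hinj : Function.Injective (fderiv ℝ Ψ x)) (hv : fderiv ℝ Ψ x v = V (Ψ x)) :
    coords Ψ V x = v := by
  rw [coords, ← hv]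
  exact Function.leftInverse_invFun hinj v

theorem hasFDerivAt_apply (i : Fin 2) (x : E2) :
    HasFDerivAt (fun y : E2 => y i) (EuclideanSpace.proj i : E2 →L[ℝ] ℝ) x :=
  (EuclideanSpace.proj i : E2 →L[ℝ] ℝ).hasFDerivAt

theorem hasFDerivAt_comp_apply {f : ℝ → ℝ} {f' : ℝ} {x : E2} {i : Fin 2}
    (hf : HasDerivAt f f' (x i)) :
    HasFDerivAt (fun y : E2 => f (y i)) (f' • (EuclideanSpace.proj i : E2 →L[ℝ] ℝ)) x :=
  hf.comp_hasFDerivAt x (hasFDerivAt_apply i x)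

theorem eventually_apply {p : ℝ → Prop} {x : E2} {i : Fin 2} (h : ∀ᶠ r in 𝓝 (x i), p r) :
    ∀ᶠ y in 𝓝 x, p (y i) :=
  (hasFDerivAt_apply i x).continuousAt.eventually h

theorem hasFDerivAt_of_components {n : ℕ} {f : E2 → EuclideanSpace ℝ (Fin n)}
    {f' : E2 →L[ℝ] EuclideanSpace ℝ (Fin n)} {x : E2}
    (h : ∀ i, HasFDerivAt (fun y => f y i) (EuclideanSpace.proj i ∘L f') x) :
    HasFDerivAt f f' x := by
  rw [← hasFDerivWithinAt_univ, hasFDerivWithinAt_euclidean]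
  exact fun i => (h i).hasFDerivWithinAt

theorem hasFDerivAt_mk {f g : E2 → ℝ} {f' g' : E2 →L[ℝ] ℝ} {x : E2}
    (hf : HasFDerivAt f f' x) (hg : HasFDerivAt g g' x) :
    HasFDerivAt (fun y => (!₂[f y, g y] : E2))
      (f'.smulRight (e 0) + g'.smulRight (e 1)) x := by
  refine hasFDerivAt_of_components fun i => ?_
  fin_cases i
  · exact hf.congr_fderiv (by ext v; simp [e])
  · exact hg.congr_fderiv (by ext v; simp [e])

end LocalParam

/-! ### Metric and Levi-Civita connection in the coordinates `(r, θ)`. -/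

namespace ProfileCurve

open LocalParam Filter Topology

section Profile

variable (c : ProfileCurve) {r : ℝ}

theorem contDiffOn_c₁ : ContDiffOn ℝ ∞ c.c₁ (Ioo (-c.d) c.d) :=
  c.smooth₁.mono Ioo_subset_Icc_self

theorem contDiffOn_c₂ : ContDiffOn ℝ ∞ c.c₂ (Ioo (-c.d) c.d) :=
  c.smooth₂.mono Ioo_subset_Icc_self

theorem contDiffAt_c₁ (hr : r ∈ Ioo (-c.d) c.d) : ContDiffAt ℝ ∞ c.c₁ r :=
  c.contDiffOn_c₁.contDiffAt (isOpen_Ioo.mem_nhds hr)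

theorem contDiffAt_c₂ (hr : r ∈ Ioo (-c.d) c.d) : ContDiffAt ℝ ∞ c.c₂ r :=
  c.contDiffOn_c₂.contDiffAt (isOpen_Ioo.mem_nhds hr)

theorem contDiffAt_deriv_c₁ (hr : r ∈ Ioo (-c.d) c.d) : ContDiffAt ℝ ∞ (deriv c.c₁) r :=
  (c.contDiffOn_c₁.deriv_of_isOpen (m := ∞) isOpen_Ioo (by norm_num)).contDiffAt
    (isOpen_Ioo.mem_nhds hr)

theorem hasDerivAt_c₁ (hr : r ∈ Ioo (-c.d) c.d) : HasDerivAt c.c₁ (deriv c.c₁ r) r :=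
  ((c.contDiffAt_c₁ hr).differentiableAt (by simp)).hasDerivAt

theorem hasDerivAt_c₂ (hr : r ∈ Ioo (-c.d) c.d) : HasDerivAt c.c₂ (deriv c.c₂ r) r :=
  ((c.contDiffAt_c₂ hr).differentiableAt (by simp)).hasDerivAt

theorem hasDerivAt_deriv_c₁ (hr : r ∈ Ioo (-c.d) c.d) :
    HasDerivAt (deriv c.c₁) (iteratedDeriv 2 c.c₁ r) r := by
  rw [iteratedDeriv_succ, iteratedDeriv_one]
  exact ((c.contDiffAt_deriv_c₁ hr).differentiableAt (by simp)).hasDerivAt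

/-- The height determines the meridian parameter `r` of a point, which `param_inj` needs. -/
theorem strictMonoOn_c₂ : StrictMonoOn c.c₂ (Ioo (-c.d) c.d) := by
  refine strictMonoOn_of_deriv_pos (convex_Ioo _ _) c.contDiffOn_c₂.continuousOn ?_
  rw [interior_Ioo]
  exact c.increasing

theorem Ioo_mem_nhds (hr : r ∈ Ioo (-c.d) c.d) : ∀ᶠ t in 𝓝 r, t ∈ Ioo (-c.d) c.d :=
  isOpen_Ioo.mem_nhds hr

end Profile

section Param

variable (c : ProfileCurve) {x : E2}

theorem hasFDerivAt_param (hx : x 0 ∈ Ioo (-c.d) c.d) :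
    HasFDerivAt c.param
      ((EuclideanSpace.proj 0 : E2 →L[ℝ] ℝ).smulRight
          (!₂[deriv c.c₁ (x 0) * Real.cos (x 1), deriv c.c₁ (x 0) * Real.sin (x 1),
            deriv c.c₂ (x 0)] : E3) +
        (EuclideanSpace.proj 1 : E2 →L[ℝ] ℝ).smulRight
          (!₂[-(c.c₁ (x 0) * Real.sin (x 1)), c.c₁ (x 0) * Real.cos (x 1), 0] : E3)) x := by
  have h1 := hasFDerivAt_comp_apply (c.hasDerivAt_c₁ hx)
  have h2 := hasFDerivAt_comp_apply (c.hasDerivAt_c₂ hx)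
  have hcos := hasFDerivAt_comp_apply (Real.hasDerivAt_cos (x 1))
  have hsin := hasFDerivAt_comp_apply (Real.hasDerivAt_sin (x 1))
  refine hasFDerivAt_of_components fun i => ?_
  fin_cases i
  · exact (h1.mul hcos).congr_fderiv (by ext v; simp; ring)
  · exact (h1.mul hsin).congr_fderiv (by ext v; simp; ring)
  · exact h2.congr_fderiv (by ext v; simp; ring)

theorem frame_zero (hx : x 0 ∈ Ioo (-c.d) c.d) :
    frame c.param 0 x = !₂[deriv c.c₁ (x 0) * Real.cos (x 1),
      deriv c.c₁ (x 0) * Real.sin (x 1), deriv c.c₂ (x 0)] := by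
  rw [frame, (c.hasFDerivAt_param hx).fderiv]
  ext i
  fin_cases i <;> simp [e]

theorem frame_one (hx : x 0 ∈ Ioo (-c.d) c.d) :
    frame c.param 1 x = !₂[-(c.c₁ (x 0) * Real.sin (x 1)), c.c₁ (x 0) * Real.cos (x 1), 0] := by
  rw [frame, (c.hasFDerivAt_param hx).fderiv]
  ext i
  fin_cases i <;> simp [e]

theorem gram_param (hx : x 0 ∈ Ioo (-c.d) c.d) :
    gram c.param x = !![1, 0; 0, c.c₁ (x 0) ^ 2] := by
  have h1 := c.arclength _ hx
  have h2 := Real.sin_sq_add_cos_sq (x 1)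
  ext i j
  simp only [gram, Matrix.of_apply, PiLp.inner_apply, Fin.sum_univ_three]
  fin_cases i <;> fin_cases j <;> simp [c.frame_zero hx, c.frame_one hx, mul_pow]
  · linear_combination h1 + deriv c.c₁ (x 0) ^ 2 * h2
  · ring
  · ring
  · linear_combination c.c₁ (x 0) ^ 2 * h2

theorem gram_param_eventually (hx : x 0 ∈ Ioo (-c.d) c.d) :
    ∀ᶠ y in 𝓝 x, gram c.param y = !![1, 0; 0, c.c₁ (y 0) ^ 2] :=
  (eventually_apply (c.Ioo_mem_nhds hx)).mono fun _ hy => c.gram_param hy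

theorem density_param (hx : x 0 ∈ Ioo (-c.d) c.d) : density c.param x = c.c₁ (x 0) := by
  rw [density, c.gram_param hx, Matrix.det_fin_two_of]
  simpa using Real.sqrt_sq (c.pos _ hx).le

theorem metric_param (hx : x 0 ∈ Ioo (-c.d) c.d) (v w : E2) :
    metric c.param x v w = v 0 * w 0 + c.c₁ (x 0) ^ 2 * (v 1 * w 1) := by
  simp only [metric, c.gram_param hx, Fin.sum_univ_two]
  simp
  ring

/-- Pairing a kernel vector with the frame tests it against the Gram matrix, which is diagonal with
entries `1` and `c₁² ≠ 0`. -/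
theorem injective_fderiv_param (hx : x 0 ∈ Ioo (-c.d) c.d) :
    Function.Injective (fderiv ℝ c.param x) := by
  rw [injective_iff_map_eq_zero]
  intro v hv
  rw [fderiv_apply_eq_frame] at hv
  have hm : ∀ w : E3, inner ℝ w (v 0 • frame c.param 0 x + v 1 • frame c.param 1 x) = 0 := by
    simp [hv]
  have hg : ∀ i j, inner ℝ (frame c.param i x) (frame c.param j x) =
      (!![1, 0; 0, c.c₁ (x 0) ^ 2] : Matrix (Fin 2) (Fin 2) ℝ) i j := by
    intro i j
    rw [← c.gram_param hx, gram, Matrix.of_apply]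
  have h0 := hm (frame c.param 0 x)
  have h1 := hm (frame c.param 1 x)
  simp only [inner_add_right, real_inner_smul_right, hg] at h0 h1
  simp at h0 h1
  exact vec2_ext h0 (h1.resolve_right (c.pos _ hx).ne')

theorem gram_inv_param (hx : x 0 ∈ Ioo (-c.d) c.d) :
    (gram c.param x)⁻¹ = !![1, 0; 0, (c.c₁ (x 0) ^ 2)⁻¹] := by
  have h := (c.pos _ hx).ne'
  rw [c.gram_param hx]
  refine Matrix.inv_eq_right_inv ?_
  ext i j
  fin_cases i <;> fin_cases j <;> simp [Matrix.mul_apply, Fin.sum_univ_two, h]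

theorem pd_gram_param (hx : x 0 ∈ Ioo (-c.d) c.d) (i j k : Fin 2) :
    pd i (fun y => gram c.param y j k) x =
      if i = 0 ∧ j = 1 ∧ k = 1 then 2 * c.c₁ (x 0) * deriv c.c₁ (x 0) else 0 := by
  have hev : (fun y => gram c.param y j k) =ᶠ[𝓝 x]
      fun y => (!![1, 0; 0, c.c₁ (y 0) ^ 2] : Matrix (Fin 2) (Fin 2) ℝ) j k :=
    (c.gram_param_eventually hx).mono fun y hy => by simp only [hy]
  have hd : HasFDerivAt (fun y : E2 => c.c₁ (y 0) ^ 2)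
      ((2 * c.c₁ (x 0) * deriv c.c₁ (x 0)) • (EuclideanSpace.proj 0 : E2 →L[ℝ] ℝ)) x :=
    hasFDerivAt_comp_apply (f := fun t => c.c₁ t ^ 2) (by
      simpa using (c.hasDerivAt_c₁ hx).fun_pow 2)
  rw [pd, hev.fderiv_eq]
  fin_cases j <;> fin_cases k <;> simp
  rw [hd.fderiv]
  fin_cases i <;> simp [e]

theorem christoffel_param (hx : x 0 ∈ Ioo (-c.d) c.d) (k i j : Fin 2) :
    christoffel c.param k i j x =
      if k = 0 then (if i = 1 ∧ j = 1 then -(c.c₁ (x 0) * deriv c.c₁ (x 0)) else 0)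
      else (if i = j then 0 else deriv c.c₁ (x 0) / c.c₁ (x 0)) := by
  have h := (c.pos _ hx).ne'
  simp only [christoffel, c.gram_inv_param hx, c.pd_gram_param hx, Fin.sum_univ_two]
  fin_cases k <;> fin_cases i <;> fin_cases j <;> simp <;> field_simp

theorem nabla_param_zero (hx : x 0 ∈ Ioo (-c.d) c.d) (v w : E2 → E2) :
    nabla c.param v w x 0 = fderiv ℝ (fun y => w y 0) x (v x)
      - c.c₁ (x 0) * deriv c.c₁ (x 0) * (v x 1 * w x 1) := by
  simp [nabla, c.christoffel_param hx, Fin.sum_univ_two]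
  ring

theorem nabla_param_one (hx : x 0 ∈ Ioo (-c.d) c.d) (v w : E2 → E2) :
    nabla c.param v w x 1 = fderiv ℝ (fun y => w y 1) x (v x)
      + deriv c.c₁ (x 0) / c.c₁ (x 0) * (v x 0 * w x 1 + v x 1 * w x 0) := by
  simp [nabla, c.christoffel_param hx, Fin.sum_univ_two]
  ring

end Param

end ProfileCurve

/-! ### The Misiołek integrand. -/

namespace LocalParam

open Filter Topology

theorem lieBracket_zonal {F b : ℝ → ℝ} {F' b' : ℝ} {x : E2}
    (hF : HasDerivAt F F' (x 0)) (hb : HasDerivAt b b' (x 0)) :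
    VectorField.lieBracket ℝ (fun y : E2 => (!₂[0, F (y 0)] : E2))
        (fun y : E2 => (!₂[Real.sin (y 1), b (y 0) * Real.cos (y 1)] : E2)) x =
      !₂[F (x 0) * Real.cos (x 1), -((F (x 0) * b (x 0) + F') * Real.sin (x 1))] := by
  have hv := hasFDerivAt_mk (hasFDerivAt_const (0 : ℝ) x) (hasFDerivAt_comp_apply hF)
  have hw := hasFDerivAt_mk (hasFDerivAt_comp_apply (Real.hasDerivAt_sin (x 1)))
    ((hasFDerivAt_comp_apply hb).fun_mul (hasFDerivAt_comp_apply (Real.hasDerivAt_cos (x 1))))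
  rw [VectorField.lieBracket, hv.fderiv, hw.fderiv]
  refine vec2_ext ?_ ?_ <;> simp [e] <;> ring

end LocalParam

namespace ProfileCurve

open LocalParam Filter Topology

/-- The integrand of the Misiołek curvature where `V = F(r) ∂_θ` and
`W = sin θ ∂_r + (c₁'(r) / c₁(r)) cos θ ∂_θ`. -/
theorem misiolekIntegrand_zonal (c : ProfileCurve) {x : E2} (hx : x 0 ∈ Ioo (-c.d) c.d)
    {F : ℝ → ℝ} (hF : ContDiffAt ℝ 2 F (x 0)) {V W : E3 → E3}
    (hV : coords c.param V =ᶠ[𝓝 x] fun y => !₂[0, F (y 0)])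
    (hW : coords c.param W =ᶠ[𝓝 x]
      fun y => !₂[Real.sin (y 1), deriv c.c₁ (y 0) / c.c₁ (y 0) * Real.cos (y 1)]) :
    misiolekIntegrand c.param V W x =
      (-F (x 0) ^ 2 + 2 * deriv c.c₁ (x 0) ^ 2 * F (x 0) ^ 2
        + 2 * c.c₁ (x 0) * deriv c.c₁ (x 0) * (F (x 0) * deriv F (x 0))) * Real.sin (x 1) ^ 2
      + deriv c.c₁ (x 0) ^ 2 * F (x 0) ^ 2 * Real.cos (x 1) ^ 2 := by
  have hc := (c.pos _ hx).ne'
  set k : ℝ → ℝ := fun t => deriv c.c₁ t / c.c₁ t with hk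
  have hkd : ∀ t ∈ Ioo (-c.d) c.d, DifferentiableAt ℝ k t := fun t ht =>
    (c.hasDerivAt_deriv_c₁ ht).differentiableAt.div (c.hasDerivAt_c₁ ht).differentiableAt
      (c.pos _ ht).ne'
  have hF1 : ∀ᶠ t in 𝓝 (x 0), HasDerivAt F (deriv F t) t :=
    (hF.eventually (by simp)).mono fun t ht => (ht.differentiableAt (by simp)).hasDerivAt
  -- `F''` does not appear in the result, because `b` is only differentiated along `∂_θ`. The total
  -- derivative of `b` must nevertheless exist for `fderiv` to have its usual meaning.
  have hF2 : DifferentiableAt ℝ (deriv F) (x 0) :=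
    ((hF.fderiv_right (m := 1) (by norm_num)).clm_apply contDiffAt_const).differentiableAt
      (by simp)
  set b := VectorField.lieBracket ℝ (coords c.param V) (coords c.param W) with hb_def
  have hb : b =ᶠ[𝓝 x] fun y => !₂[F (y 0) * Real.cos (y 1),
      -((F (y 0) * k (y 0) + deriv F (y 0)) * Real.sin (y 1))] := by
    filter_upwards [hV.eventuallyEq_nhds, hW.eventuallyEq_nhds, eventually_apply hF1,
      eventually_apply (c.Ioo_mem_nhds hx)] with y hVy hWy hFy hy
    rw [hb_def, hVy.lieBracket_vectorField_eq hWy]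
    exact lieBracket_zonal hFy (hkd _ hy).hasDerivAt
  have hcos := hasFDerivAt_comp_apply (Real.hasDerivAt_cos (x 1))
  have hsin := hasFDerivAt_comp_apply (Real.hasDerivAt_sin (x 1))
  have hFx := hasFDerivAt_comp_apply hF1.self_of_nhds
  have hGx := hasFDerivAt_comp_apply
    (((hF1.self_of_nhds.mul (hkd _ hx).hasDerivAt).add hF2.hasDerivAt))
  have hb0 : fderiv ℝ (fun y => b y 0) x = _ :=
    (hb.fun_comp (fun z : E2 => z 0)).fderiv_eq.trans (hFx.mul hcos).fderiv
  have hb1 : fderiv ℝ (fun y => b y 1) x = _ :=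
    (hb.fun_comp (fun z : E2 => z 1)).fderiv_eq.trans (hGx.mul hsin).neg.fderiv
  have hv0 : fderiv ℝ (fun y => coords c.param V y 0) x = _ :=
    (hV.fun_comp (fun z : E2 => z 0)).fderiv_eq.trans (hasFDerivAt_const (0 : ℝ) x).fderiv
  have hv1 : fderiv ℝ (fun y => coords c.param V y 1) x = _ :=
    (hV.fun_comp (fun z : E2 => z 1)).fderiv_eq.trans hFx.fderiv
  simp only [misiolekIntegrand, ← hb_def, c.metric_param hx, PiLp.add_apply,
    c.nabla_param_zero hx, c.nabla_param_one hx, hb0, hb1, hv0, hv1,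
    hV.self_of_nhds, hW.self_of_nhds, hb.self_of_nhds]
  simp [hk]
  field_simp
  ring

/-- The integrand of the Misiołek curvature vanishes where `V` does. -/
theorem misiolekIntegrand_eq_zero (c : ProfileCurve) {x : E2} (hx : x 0 ∈ Ioo (-c.d) c.d)
    {V W : E3 → E3} (hV : coords c.param V =ᶠ[𝓝 x] fun _ => 0) :
    misiolekIntegrand c.param V W x = 0 := by
  set b := VectorField.lieBracket ℝ (coords c.param V) (coords c.param W) with hb_def
  have hb : b =ᶠ[𝓝 x] fun _ => 0 := by
    filter_upwards [hV.eventuallyEq_nhds] with y hVy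
    rw [hb_def, hVy.lieBracket_vectorField_eq (EventuallyEq.refl _ _), VectorField.lieBracket]
    simp
  simp [misiolekIntegrand, ← hb_def, c.metric_param hx, c.nabla_param_zero hx,
    c.nabla_param_one hx, hV.self_of_nhds, hb.self_of_nhds]

end ProfileCurve

/-! ### Polar charts around the two poles. -/

namespace ProfileCurve

open LocalParam Filter Topology

/-- The polar chart around the pole `c(-σ d)`, where `σ = ±1`. -/
noncomputable def polarChart (c : ProfileCurve) (σ : ℝ) (x : E2) : E3 :=
  !₂[c.c₁ (σ * (‖x‖ - c.d)) * (x 0 / ‖x‖), c.c₁ (σ * (‖x‖ - c.d)) * (x 1 / ‖x‖),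
    c.c₂ (σ * (‖x‖ - c.d))]

theorem southChart_eq (c : ProfileCurve) : c.southChart = c.polarChart 1 := by
  ext x i
  simp [southChart, polarChart]

theorem northChart_eq (c : ProfileCurve) : c.northChart = c.polarChart (-1) := by
  ext x i
  simp [northChart, polarChart]

/-- The passage from the coordinates `(r, θ)` to the polar chart. -/
noncomputable def toPolar (c : ProfileCurve) (σ : ℝ) (y : E2) : E2 :=
  !₂[(c.d + σ * y 0) * Real.cos (y 1), (c.d + σ * y 0) * Real.sin (y 1)]

/-- The differential of `toPolar`. -/
noncomputable def toPolarDeriv (c : ProfileCurve) (σ : ℝ) (y v : E2) : E2 :=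
  !₂[σ * v 0 * Real.cos (y 1) - (c.d + σ * y 0) * v 1 * Real.sin (y 1),
    σ * v 0 * Real.sin (y 1) + (c.d + σ * y 0) * v 1 * Real.cos (y 1)]

section Sign

variable (c : ProfileCurve) {σ : ℝ}

theorem radius_pos (hσ : σ = 1 ∨ σ = -1) {r : ℝ} (hr : r ∈ Ioo (-c.d) c.d) : 0 < c.d + σ * r := by
  obtain ⟨h1, h2⟩ := hr
  rcases hσ with rfl | rfl <;> linarith

theorem norm_toPolar (hσ : σ = 1 ∨ σ = -1) {y : E2} (hy : y 0 ∈ Ioo (-c.d) c.d) :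
    ‖c.toPolar σ y‖ = c.d + σ * y 0 := by
  have h := c.radius_pos hσ hy
  rw [EuclideanSpace.norm_eq, Fin.sum_univ_two, ← Real.sqrt_sq h.le]
  congr 1
  simp only [toPolar, Real.norm_eq_abs, sq_abs]
  simp
  linear_combination (c.d + σ * y 0) ^ 2 * Real.sin_sq_add_cos_sq (y 1)

theorem sign_mul_norm_toPolar (hσ : σ = 1 ∨ σ = -1) {y : E2} (hy : y 0 ∈ Ioo (-c.d) c.d) :
    σ * (‖c.toPolar σ y‖ - c.d) = y 0 := by
  rw [c.norm_toPolar hσ hy]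
  rcases hσ with rfl | rfl <;> ring

theorem toPolar_ne_zero (hσ : σ = 1 ∨ σ = -1)
    {y : E2} (hy : y 0 ∈ Ioo (-c.d) c.d) : c.toPolar σ y ≠ 0 := by
  rw [← norm_pos_iff, c.norm_toPolar hσ hy]
  exact c.radius_pos hσ hy

theorem toPolar_mem_ball (hσ : σ = 1 ∨ σ = -1) {y : E2} (hy : y 0 ∈ Ioo (-c.d) c.d) :
    c.toPolar σ y ∈ ball (0 : E2) (2 * c.d) := by
  rw [mem_ball_zero_iff, c.norm_toPolar hσ hy]
  obtain ⟨h1, h2⟩ := hy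
  rcases hσ with rfl | rfl <;> linarith

theorem polarChart_toPolar (hσ : σ = 1 ∨ σ = -1) {y : E2} (hy : y 0 ∈ Ioo (-c.d) c.d) :
    c.polarChart σ (c.toPolar σ y) = c.param y := by
  have h := (c.radius_pos hσ hy).ne'
  rw [polarChart, c.sign_mul_norm_toPolar hσ hy, c.norm_toPolar hσ hy, param]
  simp [toPolar, h]

theorem sign_mul_mem (hσ : σ = 1 ∨ σ = -1)
    {x : E2} (hx : x ∈ ball (0 : E2) (2 * c.d)) (hx0 : x ≠ 0) :
    σ * (‖x‖ - c.d) ∈ Ioo (-c.d) c.d := by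
  rw [mem_ball_zero_iff] at hx
  have := norm_pos_iff.mpr hx0
  rcases hσ with rfl | rfl <;> constructor <;> linarith

theorem exists_toPolar_eq (hσ : σ = 1 ∨ σ = -1)
    {x : E2} (hx : x ∈ ball (0 : E2) (2 * c.d)) (hx0 : x ≠ 0) :
    ∃ y : E2, y 0 ∈ Ioo (-c.d) c.d ∧ c.toPolar σ y = x := by
  have hn : ‖(⟨x 0, x 1⟩ : ℂ)‖ = ‖x‖ := by
    rw [EuclideanSpace.norm_eq, Fin.sum_univ_two, Complex.norm_eq_sqrt_sq_add_sq]
    simp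
  have hσ2 : c.d + σ * (σ * (‖x‖ - c.d)) = ‖x‖ := by
    rcases hσ with rfl | rfl <;> ring
  refine ⟨!₂[σ * (‖x‖ - c.d), Complex.arg ⟨x 0, x 1⟩], c.sign_mul_mem hσ hx hx0, ?_⟩
  refine vec2_ext ?_ ?_
  · have := Complex.norm_mul_cos_arg ⟨x 0, x 1⟩
    simp only [hn] at this
    simpa [toPolar, hσ2] using this
  · have := Complex.norm_mul_sin_arg ⟨x 0, x 1⟩
    simp only [hn] at this
    simpa [toPolar, hσ2] using this

theorem differentiableAt_polarChart (hσ : σ = 1 ∨ σ = -1)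
    {x : E2} (hx : x ∈ ball (0 : E2) (2 * c.d)) (hx0 : x ≠ 0) :
    DifferentiableAt ℝ (c.polarChart σ) x := by
  have hr := c.sign_mul_mem hσ hx hx0
  have hn : DifferentiableAt ℝ (fun y : E2 => ‖y‖) x := differentiableAt_id.norm ℝ hx0
  have hr' : DifferentiableAt ℝ (fun y : E2 => σ * (‖y‖ - c.d)) x := (hn.sub_const _).const_mul _
  have h1 : DifferentiableAt ℝ (fun y : E2 => c.c₁ (σ * (‖y‖ - c.d))) x :=
    (c.hasDerivAt_c₁ hr).differentiableAt.comp x hr'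
  have h2 : DifferentiableAt ℝ (fun y : E2 => c.c₂ (σ * (‖y‖ - c.d))) x :=
    (c.hasDerivAt_c₂ hr).differentiableAt.comp x hr'
  have hi : ∀ i : Fin 2, DifferentiableAt ℝ (fun y : E2 => y i / ‖y‖) x := fun i => by
    simp only [div_eq_mul_inv]
    exact (hasFDerivAt_apply i x).differentiableAt.fun_mul (hn.fun_inv (norm_ne_zero_iff.mpr hx0))
  rw [differentiableAt_euclidean]
  intro i
  fin_cases i
  · exact h1.mul (hi 0)
  · exact h1.mul (hi 1)
  · exact h2

theorem hasFDerivAt_toPolar (y : E2) :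
    ∃ L : E2 →L[ℝ] E2, HasFDerivAt (c.toPolar σ) L y ∧ ∀ v, L v = c.toPolarDeriv σ y v := by
  have ht : HasFDerivAt (fun z : E2 => c.d + σ * z 0)
      (σ • (EuclideanSpace.proj 0 : E2 →L[ℝ] ℝ)) y :=
    ((hasFDerivAt_apply 0 y).const_mul σ).const_add c.d
  have hcos := hasFDerivAt_comp_apply (Real.hasDerivAt_cos (y 1))
  have hsin := hasFDerivAt_comp_apply (Real.hasDerivAt_sin (y 1))
  refine ⟨_, hasFDerivAt_mk (ht.fun_mul hcos) (ht.fun_mul hsin), fun v => ?_⟩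
  refine vec2_ext ?_ ?_ <;> simp [e, toPolarDeriv] <;> ring

/-- Chain rule for `polarChart ∘ toPolar = param`. It transfers injectivity of the differential and
coordinates of fields from `(r, θ)` to the polar chart. -/
theorem fderiv_polarChart_toPolar (hσ : σ = 1 ∨ σ = -1)
    {y : E2} (hy : y 0 ∈ Ioo (-c.d) c.d) (v : E2) :
    fderiv ℝ (c.polarChart σ) (c.toPolar σ y) (c.toPolarDeriv σ y v) = fderiv ℝ c.param y v := by
  obtain ⟨L, hL, hLv⟩ := c.hasFDerivAt_toPolar (σ := σ) y
  have hd := c.differentiableAt_polarChart hσ (c.toPolar_mem_ball hσ hy) (c.toPolar_ne_zero hσ hy)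
  have hev : c.polarChart σ ∘ c.toPolar σ =ᶠ[𝓝 y] c.param :=
    (eventually_apply (c.Ioo_mem_nhds hy)).mono fun z hz => c.polarChart_toPolar hσ hz
  rw [← hev.fderiv_eq, (hd.hasFDerivAt.comp y hL).fderiv, ← hLv]
  rfl

theorem toPolarDeriv_surjective (hσ : σ = 1 ∨ σ = -1) {y : E2} (hy : y 0 ∈ Ioo (-c.d) c.d) :
    Function.Surjective (c.toPolarDeriv σ y) := by
  intro w
  have ht := (c.radius_pos hσ hy).ne'
  have hσ2 : σ * σ = 1 := by rcases hσ with rfl | rfl <;> norm_num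
  have hcs := Real.sin_sq_add_cos_sq (y 1)
  refine ⟨!₂[σ * (w 0 * Real.cos (y 1) + w 1 * Real.sin (y 1)),
    (w 1 * Real.cos (y 1) - w 0 * Real.sin (y 1)) / (c.d + σ * y 0)], ?_⟩
  refine vec2_ext ?_ ?_
  · simp [toPolarDeriv, ← mul_assoc, hσ2]
    field_simp
    linear_combination w 0 * hcs
  · simp [toPolarDeriv, ← mul_assoc, hσ2]
    field_simp
    linear_combination w 1 * hcs

theorem injective_fderiv_polarChart_toPolar (hσ : σ = 1 ∨ σ = -1)
    {y : E2} (hy : y 0 ∈ Ioo (-c.d) c.d) :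
    Function.Injective (fderiv ℝ (c.polarChart σ) (c.toPolar σ y)) := by
  rw [injective_iff_map_eq_zero]
  intro w hw
  obtain ⟨v, rfl⟩ := c.toPolarDeriv_surjective hσ hy w
  rw [c.fderiv_polarChart_toPolar hσ hy] at hw
  rw [(injective_iff_map_eq_zero _).mp (c.injective_fderiv_param hy) v hw]
  refine vec2_ext ?_ ?_ <;> simp [toPolarDeriv]

theorem coords_polarChart_toPolar (hσ : σ = 1 ∨ σ = -1)
    {y : E2} (hy : y 0 ∈ Ioo (-c.d) c.d) {V : E3 → E3} {v : E2}
    (hV : V (c.param y) = fderiv ℝ c.param y v) :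
    coords (c.polarChart σ) V (c.toPolar σ y) = c.toPolarDeriv σ y v := by
  refine coords_eq_of_fderiv (c.injective_fderiv_polarChart_toPolar hσ hy) ?_
  rw [c.fderiv_polarChart_toPolar hσ hy, c.polarChart_toPolar hσ hy, hV]

theorem neg_sign_mul_mem (hσ : σ = 1 ∨ σ = -1) : -(σ * c.d) ∈ Icc (-c.d) c.d := by
  have := c.d_pos
  rcases hσ with rfl | rfl <;> constructor <;> linarith

theorem c₁_pole (hσ : σ = 1 ∨ σ = -1) : c.c₁ (-(σ * c.d)) = 0 := by
  rcases hσ with rfl | rfl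
  · simpa using c.zero_left
  · simpa using c.zero_right

theorem hasDerivWithinAt_c₁_pole (hσ : σ = 1 ∨ σ = -1) :
    HasDerivWithinAt c.c₁ σ (Icc (-c.d) c.d) (-(σ * c.d)) := by
  have h : derivWithin c.c₁ (Icc (-c.d) c.d) (-(σ * c.d)) = σ := by
    rcases hσ with rfl | rfl
    · simpa using c.deriv_left
    · simpa using c.deriv_right
  have := ((c.smooth₁ _ (c.neg_sign_mul_mem hσ)).differentiableWithinAt (by simp)).hasDerivWithinAt
  rwa [h] at this

/-- The arc length identity extends by continuity to the closed interval, and `c₁' = ±1` at the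
poles leaves nothing for `c₂'`. -/
theorem hasDerivWithinAt_c₂_pole (hσ : σ = 1 ∨ σ = -1) :
    HasDerivWithinAt c.c₂ 0 (Icc (-c.d) c.d) (-(σ * c.d)) := by
  have hlt : -c.d < c.d := by linarith [c.d_pos]
  have hu := uniqueDiffOn_Icc hlt
  have hc1 := c.smooth₁.continuousOn_derivWithin hu (by simp)
  have hc2 := c.smooth₂.continuousOn_derivWithin hu (by simp)
  have hE : EqOn (fun r => derivWithin c.c₁ (Icc (-c.d) c.d) r ^ 2 +
      derivWithin c.c₂ (Icc (-c.d) c.d) r ^ 2) (fun _ => 1) (Icc (-c.d) c.d) := by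
    refine EqOn.of_subset_closure (s := Ioo (-c.d) c.d) (fun r hr => ?_)
      ((hc1.pow 2).add (hc2.pow 2)) continuousOn_const Ioo_subset_Icc_self ?_
    · rw [derivWithin_of_mem_nhds (Icc_mem_nhds hr.1 hr.2),
        derivWithin_of_mem_nhds (Icc_mem_nhds hr.1 hr.2)]
      exact c.arclength r hr
    · rw [closure_Ioo hlt.ne]
  have hm := c.neg_sign_mul_mem hσ
  have h1 : derivWithin c.c₁ (Icc (-c.d) c.d) (-(σ * c.d)) = σ :=
    (c.hasDerivWithinAt_c₁_pole hσ).derivWithin (hu _ hm)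
  have h2 : derivWithin c.c₂ (Icc (-c.d) c.d) (-(σ * c.d)) = 0 := by
    have := hE hm
    simp only [h1] at this
    rcases hσ with rfl | rfl <;> simpa using this
  have := ((c.smooth₂ _ hm).differentiableWithinAt (by simp)).hasDerivWithinAt
  rwa [h2] at this

/-- First-order expansion at the pole in the radius `‖x‖`, as `σ (‖x‖ - d)` lies at distance `‖x‖`
from `-σ d`. -/
theorem isLittleO_comp_norm (hσ : σ = 1 ∨ σ = -1) {f : ℝ → ℝ} {f' : ℝ}
    (hf : HasDerivWithinAt f f' (Icc (-c.d) c.d) (-(σ * c.d))) :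
    (fun x : E2 => f (σ * (‖x‖ - c.d)) - f (-(σ * c.d)) - ‖x‖ * (σ * f'))
      =o[𝓝 0] fun x : E2 => x := by
  have ht : Tendsto (fun x : E2 => σ * (‖x‖ - c.d)) (𝓝 0)
      (𝓝[Icc (-c.d) c.d] (-(σ * c.d))) := by
    refine tendsto_nhdsWithin_iff.mpr ⟨?_, ?_⟩
    · have : Continuous fun x : E2 => σ * (‖x‖ - c.d) := by fun_prop
      simpa using this.tendsto 0
    · filter_upwards [ball_mem_nhds (0 : E2) (by linarith [c.d_pos] : 0 < 2 * c.d)] with x hx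
      rw [mem_ball_zero_iff] at hx
      have := norm_nonneg x
      rcases hσ with rfl | rfl <;> constructor <;> linarith
  have h := (hasDerivWithinAt_iff_isLittleO.mp hf).comp_tendsto ht
  refine (h.congr_left fun x => ?_).trans_isBigO (Asymptotics.IsBigO.of_bound 1 ?_)
  · simp only [Function.comp, smul_eq_mul]
    ring
  · refine Eventually.of_forall fun x => ?_
    have : σ * (‖x‖ - c.d) - -(σ * c.d) = σ * ‖x‖ := by ring
    simp only [Function.comp, this]
    rcases hσ with rfl | rfl <;> simp

/-- Since `c₁ = ‖x‖ + o(‖x‖)` and `c₂` is stationary to first order, the chart agrees to first order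
with the inclusion of the horizontal plane, up to a vertical translation. -/
theorem hasFDerivAt_polarChart_zero (hσ : σ = 1 ∨ σ = -1) :
    HasFDerivAt (c.polarChart σ)
      ((EuclideanSpace.proj 0 : E2 →L[ℝ] ℝ).smulRight (EuclideanSpace.single 0 1 : E3) +
        (EuclideanSpace.proj 1 : E2 →L[ℝ] ℝ).smulRight (EuclideanSpace.single 1 1 : E3)) 0 := by
  have hσ2 : σ * σ = 1 := by rcases hσ with rfl | rfl <;> norm_num
  have h1 := c.isLittleO_comp_norm hσ (c.hasDerivWithinAt_c₁_pole hσ)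
  have h2 := c.isLittleO_comp_norm hσ (c.hasDerivWithinAt_c₂_pole hσ)
  have hi : ∀ i : Fin 2, HasFDerivAt (fun x : E2 => c.c₁ (σ * (‖x‖ - c.d)) * (x i / ‖x‖))
      (EuclideanSpace.proj i : E2 →L[ℝ] ℝ) 0 := by
    intro i
    refine HasFDerivAt.of_isLittleO ?_
    simp only [sub_zero]
    refine (Asymptotics.IsBigO.of_bound 1 (Eventually.of_forall fun x => ?_)).trans_isLittleO h1
    rcases eq_or_ne x 0 with rfl | hx
    · simp
    have hn := norm_ne_zero_iff.mpr hx
    have hle : |x i / ‖x‖| ≤ 1 := by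
      rw [abs_div, abs_norm, div_le_one (norm_pos_iff.mpr hx)]
      exact PiLp.norm_apply_le x i
    have : c.c₁ (σ * (‖x‖ - c.d)) * (x i / ‖x‖) - c.c₁ (σ * (‖(0 : E2)‖ - c.d)) *
        ((0 : E2) i / ‖(0 : E2)‖) - (EuclideanSpace.proj i : E2 →L[ℝ] ℝ) x =
        (c.c₁ (σ * (‖x‖ - c.d)) - c.c₁ (-(σ * c.d)) - ‖x‖ * (σ * σ)) * (x i / ‖x‖) := by
      rw [hσ2, c.c₁_pole hσ]
      simp
      field_simp
    rw [this, norm_mul, one_mul]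
    exact mul_le_of_le_one_right (norm_nonneg _) hle
  have h3 : HasFDerivAt (fun x : E2 => c.c₂ (σ * (‖x‖ - c.d))) (0 : E2 →L[ℝ] ℝ) 0 := by
    refine HasFDerivAt.of_isLittleO ?_
    simpa using h2
  refine hasFDerivAt_of_components fun i => ?_
  fin_cases i
  · exact (hi 0).congr_fderiv (by ext v; simp)
  · exact (hi 1).congr_fderiv (by ext v; simp)
  · exact h3.congr_fderiv (by ext v; simp)

theorem coords_polarChart_zero (hσ : σ = 1 ∨ σ = -1) {V : E3 → E3} (hV : V (c.polarChart σ 0) = 0) :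
    coords (c.polarChart σ) V 0 = 0 := by
  refine coords_eq_of_fderiv ?_ (by rw [map_zero, hV])
  rw [(c.hasFDerivAt_polarChart_zero hσ).fderiv, injective_iff_map_eq_zero]
  intro v hv
  have h0 := congrArg (fun z : E3 => z 0) hv
  have h1 := congrArg (fun z : E3 => z 1) hv
  simp at h0 h1
  exact vec2_ext h0 h1

/-- The centre lies on the axis of rotation, while points of `R'(c)` are at distance `c₁ > 0` from
it. -/
theorem polarChart_zero_notMem_openSurface : c.polarChart σ 0 ∉ c.openSurface := by
  rintro ⟨r, hr, θ, h⟩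
  have h0 := congrArg (fun z : E3 => z 0) h
  have h1 := congrArg (fun z : E3 => z 1) h
  have hc := (c.pos r hr).ne'
  simp [polarChart, param, hc] at h0 h1
  have := Real.sin_sq_add_cos_sq θ
  rw [h0, h1] at this
  norm_num at this

end Sign

end ProfileCurve

/-! ### Regularity of the zonal profile, and the perturbation field. -/

namespace ProfileCurve

open LocalParam Filter Topology

theorem coords_param_zonal (c : ProfileCurve) {F : ℝ → ℝ} {V : E3 → E3}
    (hF : c.IsZonalFlow F V) {x : E2} (hx : x 0 ∈ Ioo (-c.d) c.d) :
    coords c.param V x = !₂[0, F (x 0)] := by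
  refine coords_eq_of_fderiv (c.injective_fderiv_param hx) ?_
  rw [fderiv_apply_eq_frame]
  have := hF (x 0) hx (x 1)
  rw [← vec2_eta x] at this
  simp [this]

/-- Along the ray `θ = 0` of the south chart, the second component of `V` is `(d + t) F(t)`. It is
`C²` by Sobolev embedding, and the radius `d + t` is positive. -/
theorem IsZonalFlow.contDiffAt {c : ProfileCurve} {F : ℝ → ℝ} {V : E3 → E3}
    (hF : c.IsZonalFlow F V) {s : ℝ} (hs : 3 < s) (hV : V ∈ c.divFreeFields s)
    {r : ℝ} (hr : r ∈ Ioo (-c.d) c.d) : ContDiffAt ℝ 2 F r := by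
  have hσ : (1 : ℝ) = 1 ∨ (1 : ℝ) = -1 := Or.inl rfl
  obtain ⟨-, hcont, hsob⟩ := hV.1
  rw [southChart_eq] at hcont hsob
  have hC := (hsob 1).contDiffOn hs isOpen_ball
    ((PiLp.continuous_apply 2 (fun _ : Fin 2 => ℝ) 1).comp_continuousOn hcont)
  have hax : ∀ t ∈ Ioo (-c.d) c.d,
      coords (c.polarChart 1) V (!₂[c.d + t, 0] : E2) 1 = (c.d + t) * F t := by
    intro t ht
    have h := c.coords_polarChart_toPolar hσ (y := !₂[t, 0]) ht (V := V) (v := !₂[0, F t]) (by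
      rw [fderiv_apply_eq_frame, hF t ht 0]
      simp)
    have hp : c.toPolar 1 !₂[t, 0] = !₂[c.d + t, 0] := by simp [toPolar]
    rw [hp] at h
    simp [h, toPolarDeriv]
  have hpos := c.radius_pos hσ hr
  rw [one_mul] at hpos
  have hmem : (!₂[c.d + r, 0] : E2) ∈ ball (0 : E2) (2 * c.d) := by
    have := c.toPolar_mem_ball hσ (y := !₂[r, 0]) hr
    simpa [toPolar] using this
  have hline : ContDiffAt ℝ 2 (fun t : ℝ => (!₂[c.d + t, 0] : E2)) r := by
    rw [contDiffAt_euclidean]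
    intro i
    fin_cases i
    · exact contDiffAt_const.add contDiffAt_id
    · exact contDiffAt_const
  have hnum : ContDiffAt ℝ 2
      (fun t : ℝ => coords (c.polarChart 1) V (!₂[c.d + t, 0] : E2) 1) r :=
    ContDiffAt.comp (g := fun x => coords (c.polarChart 1) V x 1) r
      (hC.contDiffAt (isOpen_ball.mem_nhds hmem)) hline
  have hcomp : ContDiffAt ℝ 2
      (fun t : ℝ => coords (c.polarChart 1) V (!₂[c.d + t, 0] : E2) 1 / (c.d + t)) r :=
    hnum.div (contDiffAt_const.add contDiffAt_id) hpos.ne'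
  refine hcomp.congr_of_eventuallyEq ?_
  filter_upwards [c.Ioo_mem_nhds hr] with t ht
  have := c.radius_pos hσ ht
  rw [one_mul] at this
  rw [hax t ht, mul_div_cancel_left₀ _ this.ne']

/-- The `θ`-component, up to the factor `cos θ`, of the field with stream function
`-c₁ h cos θ`. -/
noncomputable def angular (c : ProfileCurve) (h : ℝ → ℝ) (r : ℝ) : ℝ :=
  deriv h r + h r * deriv c.c₁ r / c.c₁ r

/-- The coordinates of `h sin θ ∂_r + (h' + h c₁' / c₁) cos θ ∂_θ`. -/
noncomputable def perturbationCoords (c : ProfileCurve) (h : ℝ → ℝ) (y : E2) : E2 :=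
  !₂[h (y 0) * Real.sin (y 1), c.angular h (y 0) * Real.cos (y 1)]

section Perturbation

variable (c : ProfileCurve) {h : ℝ → ℝ}

theorem angular_eq_zero {r : ℝ} (hr : r ∉ tsupport h) : c.angular h r = 0 := by
  have hev := notMem_tsupport_iff_eventuallyEq.mp hr
  rw [angular, hev.deriv_eq, hev.self_of_nhds]
  simp

theorem contDiff_angular (hh : ContDiff ℝ ∞ h) (hs : tsupport h ⊆ Ioo (-c.d) c.d) :
    ContDiff ℝ ∞ (c.angular h) := by
  refine contDiff_iff_contDiffAt.mpr fun r => ?_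
  by_cases hr : r ∈ tsupport h
  · have hr' := hs hr
    have hd : ContDiffAt ℝ ∞ (deriv h) r :=
      (contDiff_infty_iff_deriv.mp hh).2.contDiffAt
    exact hd.add ((hh.contDiffAt.mul (c.contDiffAt_deriv_c₁ hr')).div (c.contDiffAt_c₁ hr')
      (c.pos r hr').ne')
  · have : c.angular h =ᶠ[𝓝 r] fun _ => 0 := by
      filter_upwards [(isClosed_tsupport h).isOpen_compl.mem_nhds hr] with t ht
      exact c.angular_eq_zero ht
    exact contDiffAt_const.congr_of_eventuallyEq this

/-- After multiplication by the density the components are `c₁ h sin θ` and `(c₁ h)' cos θ`, whose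
partial derivatives cancel. -/
theorem divergence_perturbation (hh : ContDiff ℝ ∞ h) {W : E3 → E3}
    (hW : ∀ y : E2, y 0 ∈ Ioo (-c.d) c.d → coords c.param W y = c.perturbationCoords h y)
    {x : E2} (hx : x 0 ∈ Ioo (-c.d) c.d) : divergence c.param (coords c.param W) x = 0 := by
  have hev : ∀ᶠ y in 𝓝 x, density c.param y = c.c₁ (y 0) ∧
      coords c.param W y = c.perturbationCoords h y ∧ c.c₁ (y 0) ≠ 0 :=
    (eventually_apply (c.Ioo_mem_nhds hx)).mono fun y hy =>
      ⟨c.density_param hy, hW y hy, (c.pos _ hy).ne'⟩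
  have hhd : HasDerivAt h (deriv h (x 0)) (x 0) :=
    (hh.differentiable (by simp) (x 0)).hasDerivAt
  have hhd' : HasDerivAt (deriv h) (deriv (deriv h) (x 0)) (x 0) :=
    ((contDiff_infty_iff_deriv.mp hh).2.differentiable (by simp) (x 0)).hasDerivAt
  have hcos := hasFDerivAt_comp_apply (Real.hasDerivAt_cos (x 1))
  have hsin := hasFDerivAt_comp_apply (Real.hasDerivAt_sin (x 1))
  have h0 : (fun y => density c.param y * coords c.param W y 0) =ᶠ[𝓝 x]
      fun y => c.c₁ (y 0) * h (y 0) * Real.sin (y 1) := by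
    filter_upwards [hev] with y hy
    rw [hy.1, hy.2.1]
    simp [perturbationCoords]
    ring
  have h1 : (fun y => density c.param y * coords c.param W y 1) =ᶠ[𝓝 x]
      fun y => (c.c₁ (y 0) * deriv h (y 0) + h (y 0) * deriv c.c₁ (y 0)) * Real.cos (y 1) := by
    filter_upwards [hev] with y hy
    have := hy.2.2
    rw [hy.1, hy.2.1]
    simp [perturbationCoords, angular]
    field_simp
  have d0 := (hasFDerivAt_comp_apply ((c.hasDerivAt_c₁ hx).fun_mul hhd)).fun_mul hsin
  have d1 := (hasFDerivAt_comp_apply (((c.hasDerivAt_c₁ hx).fun_mul hhd').fun_add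
    (hhd.fun_mul (c.hasDerivAt_deriv_c₁ hx)))).fun_mul hcos
  rw [divergence, Fin.sum_univ_two, pd, pd, h0.fderiv_eq, h1.fderiv_eq, d0.fderiv, d1.fderiv]
  simp [e]
  ring_nf
  simp

/-- The coordinates in the polar chart of `h sin θ ∂_r + (h' + h c₁' / c₁) cos θ ∂_θ`. -/
noncomputable def perturbationPolar (c : ProfileCurve) (σ : ℝ) (h : ℝ → ℝ) (x : E2) : E2 :=
  !₂[h (σ * (‖x‖ - c.d)) * (σ * (x 0 * x 1 / ‖x‖ ^ 2)) +
      c.angular h (σ * (‖x‖ - c.d)) * -(x 0 * x 1 / ‖x‖),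
    h (σ * (‖x‖ - c.d)) * (σ * (x 1 * x 1 / ‖x‖ ^ 2)) +
      c.angular h (σ * (‖x‖ - c.d)) * (x 0 * x 0 / ‖x‖)]

theorem perturbationPolar_toPolar {σ : ℝ} (hσ : σ = 1 ∨ σ = -1) {y : E2}
    (hy : y 0 ∈ Ioo (-c.d) c.d) :
    c.perturbationPolar σ h (c.toPolar σ y) =
      c.toPolarDeriv σ y (c.perturbationCoords h y) := by
  have ht := (c.radius_pos hσ hy).ne'
  rw [perturbationPolar, c.sign_mul_norm_toPolar hσ hy, c.norm_toPolar hσ hy]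
  refine vec2_ext ?_ ?_ <;> simp [toPolar, toPolarDeriv, perturbationCoords] <;> field_simp
  ring

/-- The quotients by `‖x‖` are singular only at the centre, and there the factors `h` and `angular
h` vanish on a neighbourhood. -/
theorem contDiff_perturbationPolar {σ : ℝ} (hσ : σ = 1 ∨ σ = -1) (hh : ContDiff ℝ ∞ h)
    (hs : tsupport h ⊆ Ioo (-c.d) c.d) : ContDiff ℝ ∞ (c.perturbationPolar σ h) := by
  have key : ∀ f : ℝ → ℝ, ContDiff ℝ ∞ f → (∀ r ∉ tsupport h, f r = 0) →
      ∀ q : E2 → ℝ, (∀ x ≠ 0, ContDiffAt ℝ ∞ q x) →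
      ContDiff ℝ ∞ fun x : E2 => f (σ * (‖x‖ - c.d)) * q x := by
    intro f hf hf0 q hq
    refine contDiff_iff_contDiffAt.mpr fun x => ?_
    rcases eq_or_ne x 0 with rfl | hx
    · have hcont : ContinuousAt (fun x : E2 => σ * (‖x‖ - c.d)) 0 := by fun_prop
      have hm : σ * (‖(0 : E2)‖ - c.d) ∉ tsupport h := fun hmem => by
        have := hs hmem
        rw [norm_zero] at this
        rcases hσ with rfl | rfl <;> simp at this
      have : (fun x : E2 => f (σ * (‖x‖ - c.d)) * q x) =ᶠ[𝓝 0] fun _ => 0 := by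
        filter_upwards [hcont.eventually ((isClosed_tsupport h).isOpen_compl.mem_nhds hm)]
          with y hy
        rw [hf0 _ hy, zero_mul]
      exact contDiffAt_const.congr_of_eventuallyEq this
    · refine ContDiffAt.mul (hf.contDiffAt.comp x ?_) (hq x hx)
      exact contDiffAt_const.mul ((contDiffAt_norm ℝ hx).sub contDiffAt_const)
  have hk0 : ∀ r ∉ tsupport h, h r = 0 := fun r hr => image_eq_zero_of_notMem_tsupport hr
  have hx : ∀ (i : Fin 2) (x : E2), ContDiffAt ℝ ∞ (fun y : E2 => y i) x := fun i x =>
    (EuclideanSpace.proj i : E2 →L[ℝ] ℝ).contDiff.contDiffAt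
  have hn : ∀ (i j : Fin 2) (x : E2), x ≠ 0 →
      ContDiffAt ℝ ∞ (fun y : E2 => y i * y j / ‖y‖) x := fun i j x hx0 =>
    ((hx i x).mul (hx j x)).div (contDiffAt_norm ℝ hx0) (norm_ne_zero_iff.mpr hx0)
  have hn2 : ∀ (i j : Fin 2) (x : E2), x ≠ 0 →
      ContDiffAt ℝ ∞ (fun y : E2 => σ * (y i * y j / ‖y‖ ^ 2)) x := fun i j x hx0 =>
    contDiffAt_const.mul (((hx i x).mul (hx j x)).div ((contDiffAt_norm ℝ hx0).pow 2)
      (pow_ne_zero 2 (norm_ne_zero_iff.mpr hx0)))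
  have hang := c.contDiff_angular hh hs
  have hang0 : ∀ r ∉ tsupport h, c.angular h r = 0 := fun r hr => c.angular_eq_zero hr
  rw [contDiff_euclidean]
  intro i
  fin_cases i
  · exact (key h hh hk0 _ (hn2 0 1)).add (key _ hang hang0 _ fun x hx => (hn 0 1 x hx).neg)
  · exact (key h hh hk0 _ (hn2 1 1)).add (key _ hang hang0 _ (hn 0 0))

theorem sobolevInChart_perturbation {σ : ℝ} (hσ : σ = 1 ∨ σ = -1) (hh : ContDiff ℝ ∞ h)
    (hs : tsupport h ⊆ Ioo (-c.d) c.d) {W : E3 → E3}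
    (hW : ∀ y : E2, y 0 ∈ Ioo (-c.d) c.d →
      W (c.param y) = fderiv ℝ c.param y (c.perturbationCoords h y))
    (hW0 : W (c.polarChart σ 0) = 0) (s : ℝ) : c.SobolevInChart s (c.polarChart σ) W := by
  have hY := c.contDiff_perturbationPolar hσ hh hs
  have hcoords : EqOn (coords (c.polarChart σ) W) (c.perturbationPolar σ h)
      (ball 0 (2 * c.d)) := by
    intro x hx
    rcases eq_or_ne x 0 with rfl | hx0
    · rw [c.coords_polarChart_zero hσ hW0]
      refine vec2_ext ?_ ?_ <;> simp [perturbationPolar]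
    · obtain ⟨y, hy, rfl⟩ := c.exists_toPolar_eq hσ hx hx0
      rw [c.coords_polarChart_toPolar hσ hy (hW y hy), c.perturbationPolar_toPolar hσ hy]
  refine ⟨fun x hx => ?_, hY.continuous.continuousOn.congr hcoords, fun i χ hχ hχc hχs => ?_⟩
  · rcases eq_or_ne x 0 with rfl | hx0
    · exact ⟨0, by rw [map_zero, hW0]⟩
    · obtain ⟨y, hy, rfl⟩ := c.exists_toPolar_eq hσ hx hx0
      refine ⟨c.toPolarDeriv σ y (c.perturbationCoords h y), ?_⟩
      rw [c.fderiv_polarChart_toPolar hσ hy, c.polarChart_toPolar hσ hy, hW y hy]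
  · have heq : (fun x => χ x * coords (c.polarChart σ) W x i) =
        fun x => χ x * c.perturbationPolar σ h x i := by
      ext x
      by_cases hx : x ∈ tsupport χ
      · rw [hcoords (hχs hx)]
      · rw [image_eq_zero_of_notMem_tsupport hx, zero_mul, zero_mul]
    rw [heq]
    exact IsSobolev.of_contDiff (hχ.mul (contDiff_euclidean.mp hY i)) hχc.mul_right

open Classical in
/-- The field `h sin θ ∂_r + (h' + h c₁' / c₁) cos θ ∂_θ` on `R'(c)`, extended by zero. -/
noncomputable def perturbation (c : ProfileCurve) (h : ℝ → ℝ) (p : E3) : E3 :=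
  if hp : p ∈ c.openSurface then
    fderiv ℝ c.param !₂[hp.choose, hp.choose_spec.2.choose]
      (c.perturbationCoords h !₂[hp.choose, hp.choose_spec.2.choose])
  else 0

theorem param_inj {y z : E2} (hy : y 0 ∈ Ioo (-c.d) c.d) (hz : z 0 ∈ Ioo (-c.d) c.d)
    (hyz : c.param y = c.param z) :
    y 0 = z 0 ∧ Real.cos (y 1) = Real.cos (z 1) ∧ Real.sin (y 1) = Real.sin (z 1) := by
  have h0 := congrArg (fun q : E3 => q 0) hyz
  have h1 := congrArg (fun q : E3 => q 1) hyz
  have h2 := congrArg (fun q : E3 => q 2) hyz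
  simp only [param, PiLp.toLp_apply, Matrix.cons_val] at h0 h1 h2
  have hr : y 0 = z 0 := c.strictMonoOn_c₂.injOn hy hz h2
  have hc := (c.pos _ hz).ne'
  rw [hr] at h0 h1
  exact ⟨hr, mul_left_cancel₀ hc h0, mul_left_cancel₀ hc h1⟩

/-- The chosen preimage is immaterial: two preimages share `r`, `cos θ` and `sin θ`, and both the
frame and the components depend only on these. -/
theorem perturbation_param {y : E2} (hy : y 0 ∈ Ioo (-c.d) c.d) :
    c.perturbation h (c.param y) = fderiv ℝ c.param y (c.perturbationCoords h y) := by
  have hp : c.param y ∈ c.openSurface := ⟨y 0, hy, y 1, by rw [← vec2_eta]⟩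
  rw [perturbation, dif_pos hp]
  set z : E2 := !₂[hp.choose, hp.choose_spec.2.choose] with hz_def
  have hz : z 0 ∈ Ioo (-c.d) c.d := hp.choose_spec.1
  obtain ⟨h0, h1, h2⟩ := c.param_inj hy hz hp.choose_spec.2.choose_spec
  rw [fderiv_apply_eq_frame, fderiv_apply_eq_frame, c.frame_zero hy, c.frame_zero hz,
    c.frame_one hy, c.frame_one hz, perturbationCoords, perturbationCoords, h0, h1, h2]

theorem coords_perturbation {y : E2} (hy : y 0 ∈ Ioo (-c.d) c.d) :
    coords c.param (c.perturbation h) y = c.perturbationCoords h y :=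
  coords_eq_of_fderiv (c.injective_fderiv_param hy) (c.perturbation_param hy).symm

theorem perturbation_mem_divFreeFields (hh : ContDiff ℝ ∞ h)
    (hs : tsupport h ⊆ Ioo (-c.d) c.d) (s : ℝ) : c.perturbation h ∈ c.divFreeFields s := by
  have h0 : ∀ σ, c.perturbation h (c.polarChart σ 0) = 0 := fun σ => by
    rw [perturbation, dif_neg c.polarChart_zero_notMem_openSurface]
  refine ⟨?_, ?_, fun x hx => c.divergence_perturbation hh (fun y => c.coords_perturbation) hx⟩
  · rw [southChart_eq]
    exact c.sobolevInChart_perturbation (Or.inl rfl) hh hs (fun y => c.perturbation_param) (h0 1) s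
  · rw [northChart_eq]
    exact c.sobolevInChart_perturbation (Or.inr rfl) hh hs (fun y => c.perturbation_param)
      (h0 (-1)) s

end Perturbation

end ProfileCurve

/-! ### Integration over the coordinate rectangle. -/

theorem setIntegral_coordinates_mul_add {A B a b : ℝ → ℝ} {s t : Set ℝ}
    (hA : IntegrableOn A s) (ha : IntegrableOn a t)
    (hB : IntegrableOn B s) (hb : IntegrableOn b t) :
    ∫ x in {x : E2 | x 0 ∈ s ∧ x 1 ∈ t}, A (x 0) * a (x 1) + B (x 0) * b (x 1) =
      (∫ r in s, A r) * (∫ θ in t, a θ) + (∫ r in s, B r) * ∫ θ in t, b θ := by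
  have hmp : MeasurePreserving (fun x : E2 => MeasurableEquiv.finTwoArrow (x.ofLp)) volume
      (volume : Measure (ℝ × ℝ)) :=
    (volume_preserving_finTwoArrow ℝ).comp (PiLp.volume_preserving_ofLp (Fin 2))
  have hemb : MeasurableEmbedding (fun x : E2 => MeasurableEquiv.finTwoArrow (x.ofLp)) :=
    (MeasurableEquiv.finTwoArrow (α := ℝ)).measurableEmbedding.comp
      (MeasurableEquiv.toLp 2 (Fin 2 → ℝ)).symm.measurableEmbedding
  have h := hmp.setIntegral_preimage_emb hemb
    (fun z : ℝ × ℝ => A z.1 * a z.2 + B z.1 * b z.2) (s ×ˢ t)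
  have hint : ∀ {f g : ℝ → ℝ}, IntegrableOn f s → IntegrableOn g t →
      IntegrableOn (fun z : ℝ × ℝ => f z.1 * g z.2) (s ×ˢ t) := by
    intro f g hf hg
    rw [IntegrableOn, Measure.volume_eq_prod, ← Measure.prod_restrict]
    exact Integrable.mul_prod hf hg
  have h2 := integral_add (hint hA ha) (hint hB hb)
  rw [Measure.volume_eq_prod, setIntegral_prod_mul, setIntegral_prod_mul] at h2
  rw [← h2, ← Measure.volume_eq_prod, ← h]
  rfl

theorem setIntegral_sin_sq : ∫ θ in Ioo (-Real.pi) Real.pi, Real.sin θ ^ 2 = Real.pi := by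
  rw [← integral_Ioc_eq_integral_Ioo, ← intervalIntegral.integral_of_le (by linarith [Real.pi_pos]),
    integral_sin_sq]
  simp

theorem setIntegral_cos_sq : ∫ θ in Ioo (-Real.pi) Real.pi, Real.cos θ ^ 2 = Real.pi := by
  rw [← integral_Ioc_eq_integral_Ioo, ← intervalIntegral.integral_of_le (by linarith [Real.pi_pos]),
    integral_cos_sq]
  simp

/-! ### Support of the flow and positivity of the curvature. -/

namespace ProfileCurve

open LocalParam Filter Topology

/-- The part of `I_d` where the zonal flow does not vanish. -/
def zonalSupport (c : ProfileCurve) (F : ℝ → ℝ) : Set ℝ :=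
  closure {r | r ∈ Ioo (-c.d) c.d ∧ F r ≠ 0}

section Support

variable (c : ProfileCurve) {F : ℝ → ℝ} {V : E3 → E3}

/-- The meridian `θ = 0` is continuous up to the poles, so a pole parameter in the closure would put
the pole into the support of `V`. -/
theorem pole_notMem_zonalSupport {σ : ℝ} (hσ : σ = 1 ∨ σ = -1) (hF : c.IsZonalFlow F V)
    (hsupp : closure {p | p ∈ c.surface ∧ V p ≠ 0} ⊆ c.openSurface) :
    -(σ * c.d) ∉ c.zonalSupport F := by
  intro hmem
  have hm := c.neg_sign_mul_mem hσ
  have hcont : ContinuousOn (fun r => c.param !₂[r, 0]) (Icc (-c.d) c.d) := by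
    have h : ContinuousOn (fun r => (!₂[c.c₁ r, 0, c.c₂ r] : E3)) (Icc (-c.d) c.d) := by
      refine (PiLp.continuous_toLp 2 _).comp_continuousOn (continuousOn_pi.mpr fun i => ?_)
      fin_cases i
      · exact c.smooth₁.continuousOn
      · exact continuousOn_const
      · exact c.smooth₂.continuousOn
    simpa [param] using h
  have himg := ((hcont _ hm).mono
    (fun r hr => Ioo_subset_Icc_self hr.1 : {r | r ∈ Ioo (-c.d) c.d ∧ F r ≠ 0} ⊆ _)
    ).mem_closure_image hmem
  have hsub : (fun r => c.param !₂[r, 0]) '' {r | r ∈ Ioo (-c.d) c.d ∧ F r ≠ 0} ⊆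
      {p | p ∈ c.surface ∧ V p ≠ 0} := by
    rintro _ ⟨r, ⟨hr, hFr⟩, rfl⟩
    refine ⟨subset_closure ⟨r, hr, 0, rfl⟩, ?_⟩
    simp only
    rw [hF r hr 0, c.frame_one (x := !₂[r, 0]) hr]
    intro h0
    have := congrArg (fun z : E3 => z 1) h0
    simp [hFr, (c.pos r hr).ne'] at this
  have hopen := hsupp (closure_mono hsub himg)
  have hpole : c.param !₂[-(σ * c.d), 0] = c.polarChart σ 0 := by
    simp [param, polarChart, c.c₁_pole hσ]
  simp only [hpole] at hopen
  exact c.polarChart_zero_notMem_openSurface hopen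

/-- The support is closed in `[-d, d]` and misses both ends. The resulting gap leaves room for the
bump function and reduces all integrals to a compact interval inside `I_d`. -/
theorem exists_zonalSupport_subset_ball (hF : c.IsZonalFlow F V)
    (hsupp : closure {p | p ∈ c.surface ∧ V p ≠ 0} ⊆ c.openSurface) :
    ∃ ρ ∈ Ioo 0 c.d, c.zonalSupport F ⊆ ball 0 ρ := by
  refine exists_pos_lt_subset_ball c.d_pos isClosed_closure fun r hr => ?_
  have hI : r ∈ Icc (-c.d) c.d :=
    closure_minimal (fun t ht => Ioo_subset_Icc_self ht.1) isClosed_Icc hr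
  rw [Real.ball_eq_Ioo, zero_sub, zero_add]
  refine ⟨lt_of_le_of_ne hI.1 ?_, lt_of_le_of_ne hI.2 ?_⟩
  · rintro rfl
    exact c.pole_notMem_zonalSupport (Or.inl rfl) hF hsupp (by simpa using hr)
  · rintro rfl
    exact c.pole_notMem_zonalSupport (Or.inr rfl) hF hsupp (by simpa using hr)

theorem eventually_eq_zero_of_notMem_zonalSupport {r : ℝ} (hr : r ∈ Ioo (-c.d) c.d)
    (h : r ∉ c.zonalSupport F) : F =ᶠ[𝓝 r] fun _ => 0 := by
  filter_upwards [c.Ioo_mem_nhds hr, isClosed_closure.isOpen_compl.mem_nhds h] with t ht ht'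
  by_contra hne
  exact ht' (subset_closure ⟨ht, hne⟩)

theorem exists_ne_zero (hF : c.IsZonalFlow F V)
    (hsupp : closure {p | p ∈ c.surface ∧ V p ≠ 0} ⊆ c.openSurface)
    (hne : ∃ p ∈ c.surface, V p ≠ 0) : ∃ r ∈ Ioo (-c.d) c.d, F r ≠ 0 := by
  obtain ⟨p, hp, hVp⟩ := hne
  obtain ⟨r, hr, θ, rfl⟩ := hsupp (subset_closure ⟨hp, hVp⟩)
  refine ⟨r, hr, fun h0 => hVp ?_⟩
  rw [hF r hr θ, h0, zero_smul]

end Support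

/-- The coefficient of `sin² θ` in the integrand of the Misiołek curvature. -/
noncomputable def sinCoeff (c : ProfileCurve) (F : ℝ → ℝ) (r : ℝ) : ℝ :=
  c.c₁ r * (-F r ^ 2 + 2 * deriv c.c₁ r ^ 2 * F r ^ 2
    + 2 * c.c₁ r * deriv c.c₁ r * (F r * deriv F r))

/-- The coefficient of `cos² θ` in the integrand of the Misiołek curvature. -/
noncomputable def cosCoeff (c : ProfileCurve) (F : ℝ → ℝ) (r : ℝ) : ℝ :=
  c.c₁ r * (deriv c.c₁ r ^ 2 * F r ^ 2)

section Curvature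

variable (c : ProfileCurve) {F h : ℝ → ℝ} {V : E3 → E3}

/-- On the support `h = 1` nearby, which makes `angular h = c₁'/c₁`; off the support both sides
vanish with `F`. -/
theorem misiolekIntegrand_perturbation (hF : c.IsZonalFlow F V)
    (hF2 : ∀ r ∈ Ioo (-c.d) c.d, ContDiffAt ℝ 2 F r)
    (hh : ∀ r ∈ c.zonalSupport F, h =ᶠ[𝓝 r] fun _ => 1) {x : E2} (hx : x 0 ∈ Ioo (-c.d) c.d) :
    misiolekIntegrand c.param V (c.perturbation h) x * density c.param x =
      c.sinCoeff F (x 0) * Real.sin (x 1) ^ 2 + c.cosCoeff F (x 0) * Real.cos (x 1) ^ 2 := by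
  have hI := eventually_apply (c.Ioo_mem_nhds hx)
  have hV : coords c.param V =ᶠ[𝓝 x] fun y => !₂[0, F (y 0)] :=
    hI.mono fun y hy => c.coords_param_zonal hF hy
  rw [c.density_param hx, sinCoeff, cosCoeff]
  by_cases hs : x 0 ∈ c.zonalSupport F
  · have hW : coords c.param (c.perturbation h) =ᶠ[𝓝 x]
        fun y => !₂[Real.sin (y 1), deriv c.c₁ (y 0) / c.c₁ (y 0) * Real.cos (y 1)] := by
      filter_upwards [hI, eventually_apply (hh _ hs).eventuallyEq_nhds] with y hy hhy
      rw [c.coords_perturbation hy, perturbationCoords, angular, hhy.deriv_eq, hhy.self_of_nhds]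
      simp
    rw [c.misiolekIntegrand_zonal hx (hF2 _ hx) hV hW]
    ring
  · have hF0 := c.eventually_eq_zero_of_notMem_zonalSupport hx hs
    have hV0 : coords c.param V =ᶠ[𝓝 x] fun _ => 0 := by
      filter_upwards [hV, eventually_apply hF0] with y hy hy0
      rw [hy, hy0]
      exact vec2_ext rfl rfl
    rw [c.misiolekIntegrand_eq_zero hx hV0, hF0.deriv_eq, hF0.self_of_nhds]
    simp

theorem integral_coeff_pos
    (hc : ∀ r ∈ Ioo (-c.d) c.d, 1 < deriv c.c₁ r ^ 2 - c.c₁ r * iteratedDeriv 2 c.c₁ r)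
    (hF2 : ∀ r ∈ Ioo (-c.d) c.d, ContDiffAt ℝ 2 F r) {ρ : ℝ} (hρ : ρ ∈ Ioo 0 c.d)
    (hsupp : c.zonalSupport F ⊆ ball 0 ρ) (hne : ∃ r ∈ Ioo (-c.d) c.d, F r ≠ 0) :
    0 < ∫ r in -ρ..ρ, (c.sinCoeff F r + c.cosCoeff F r) := by
  have hlt : -ρ < ρ := by linarith [hρ.1]
  have hI : Icc (-ρ) ρ ⊆ Ioo (-c.d) c.d :=
    Icc_subset_Ioo (by linarith [hρ.2]) hρ.2
  have hF0 : ∀ r ∈ Ioo (-c.d) c.d, r ∉ ball (0 : ℝ) ρ → F r = 0 := fun r hr hr' =>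
    (c.eventually_eq_zero_of_notMem_zonalSupport hr fun h => hr' (hsupp h)).self_of_nhds
  have hFd : ∀ r ∈ Icc (-ρ) ρ, HasDerivAt F (deriv F r) r := fun r hr =>
    ((hF2 r (hI hr)).differentiableAt (by simp)).hasDerivAt
  have hFc : ContinuousOn F (Icc (-ρ) ρ) := fun r hr =>
    (hFd r hr).continuousAt.continuousWithinAt
  have hF'c : ContinuousOn (deriv F) (Icc (-ρ) ρ) := fun r hr =>
    (((hF2 r (hI hr)).fderiv_right (m := 1) (by norm_num)).clm_apply
      contDiffAt_const).continuousAt.continuousWithinAt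
  have hc₁ : ContinuousOn c.c₁ (Icc (-ρ) ρ) := fun r hr =>
    (c.hasDerivAt_c₁ (hI hr)).continuousAt.continuousWithinAt
  have hc₁' : ContinuousOn (deriv c.c₁) (Icc (-ρ) ρ) := fun r hr =>
    (c.hasDerivAt_deriv_c₁ (hI hr)).continuousAt.continuousWithinAt
  have hc₁'' : ContinuousOn (iteratedDeriv 2 c.c₁) (Icc (-ρ) ρ) := fun r hr => by
    rw [iteratedDeriv_succ, iteratedDeriv_one]
    exact (((c.contDiffAt_deriv_c₁ (hI hr)).fderiv_right (m := 1) (by norm_cast)).clm_apply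
      contDiffAt_const).continuousAt.continuousWithinAt
  -- `H` is chosen so that `H'` absorbs the sign-indefinite term `2 c₁² c₁' F F'`; the remainder `P`
  -- contains `F` only through `F²`.
  set H : ℝ → ℝ := fun r => c.c₁ r ^ 2 * deriv c.c₁ r * F r ^ 2 with hH
  set P : ℝ → ℝ := fun r =>
    c.c₁ r * F r ^ 2 * (deriv c.c₁ r ^ 2 - c.c₁ r * iteratedDeriv 2 c.c₁ r - 1) with hP
  set H' : ℝ → ℝ := fun r => c.sinCoeff F r + c.cosCoeff F r - P r with hH'
  have hPc : ContinuousOn P (Icc (-ρ) ρ) := by fun_prop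
  have hH'c : ContinuousOn H' (Icc (-ρ) ρ) := by
    simp only [hH', sinCoeff, cosCoeff]
    fun_prop
  have hHd : ∀ r ∈ uIcc (-ρ) ρ, HasDerivAt H (H' r) r := by
    intro r hr
    rw [uIcc_of_le hlt.le] at hr
    refine ((((c.hasDerivAt_c₁ (hI hr)).fun_pow 2).fun_mul
      (c.hasDerivAt_deriv_c₁ (hI hr))).fun_mul ((hFd r hr).fun_pow 2)).congr_deriv ?_
    simp only [hH', hP, sinCoeff, cosCoeff]
    push_cast
    ring
  -- The ball containing the support is open, so `F` already vanishes at `±ρ`.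
  have hends : ∀ r, |r| = ρ → H r = 0 := by
    intro r hr
    have : F r = 0 := hF0 r (hI (abs_le.mp hr.le)) (by simp [hr])
    simp [hH, this]
  have hzero : ∫ r in -ρ..ρ, H' r = 0 := by
    rw [intervalIntegral.integral_eq_sub_of_hasDerivAt hHd
      (hH'c.intervalIntegrable_of_Icc hlt.le),
      hends ρ (abs_of_pos hρ.1), hends (-ρ) (by rw [abs_neg, abs_of_pos hρ.1]), sub_zero]
  have hsplit : ∫ r in -ρ..ρ, (c.sinCoeff F r + c.cosCoeff F r) = ∫ r in -ρ..ρ, P r := by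
    have := intervalIntegral.integral_add (hH'c.intervalIntegrable_of_Icc (μ := volume) hlt.le)
      (hPc.intervalIntegrable_of_Icc hlt.le)
    rw [hzero, zero_add] at this
    rw [← this]
    refine intervalIntegral.integral_congr fun r _ => ?_
    simp only [hH']
    ring
  rw [hsplit]
  obtain ⟨r, hr, hFr⟩ := hne
  refine intervalIntegral.integral_pos hlt hPc (fun t ht => ?_) ⟨r, ?_, ?_⟩
  · have ht' := hI (Ioc_subset_Icc_self ht)
    exact mul_nonneg (mul_nonneg (c.pos t ht').le (sq_nonneg _)) (by linarith [hc t ht'])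
  · by_contra hr'
    refine hFr (hF0 r hr fun hb => hr' ?_)
    rw [Real.ball_eq_Ioo, zero_sub, zero_add] at hb
    exact Ioo_subset_Icc_self hb
  · exact mul_pos (mul_pos (c.pos r hr) (by positivity)) (by linarith [hc r hr])

theorem misiolekCurvature_perturbation_pos
    (hc : ∀ r ∈ Ioo (-c.d) c.d, 1 < deriv c.c₁ r ^ 2 - c.c₁ r * iteratedDeriv 2 c.c₁ r)
    (hF : c.IsZonalFlow F V) (hF2 : ∀ r ∈ Ioo (-c.d) c.d, ContDiffAt ℝ 2 F r) {ρ : ℝ}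
    (hρ : ρ ∈ Ioo 0 c.d) (hsupp : c.zonalSupport F ⊆ ball 0 ρ)
    (hne : ∃ r ∈ Ioo (-c.d) c.d, F r ≠ 0)
    (hh : ∀ r ∈ c.zonalSupport F, h =ᶠ[𝓝 r] fun _ => 1) :
    0 < c.misiolekCurvature V (c.perturbation h) := by
  have hle : -ρ ≤ ρ := by linarith [hρ.1]
  have hI : Icc (-ρ) ρ ⊆ Ioo (-c.d) c.d :=
    Icc_subset_Ioo (by linarith [hρ.2]) hρ.2
  -- Integrability over `I_d` thereby reduces to continuity of the coefficients on the compact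
  -- interval `[-ρ, ρ]`.
  have hout : ∀ r ∈ Ioo (-c.d) c.d \ Ioc (-ρ) ρ, F =ᶠ[𝓝 r] fun _ => 0 := fun r hr =>
    c.eventually_eq_zero_of_notMem_zonalSupport hr.1 fun h => hr.2 (by
      have := hsupp h
      rw [Real.ball_eq_Ioo, zero_sub, zero_add] at this
      exact Ioo_subset_Ioc_self this)
  have hsin0 : ∀ r ∈ Ioo (-c.d) c.d \ Ioc (-ρ) ρ, c.sinCoeff F r = 0 := fun r hr => by
    simp [sinCoeff, (hout r hr).self_of_nhds]
  have hcos0 : ∀ r ∈ Ioo (-c.d) c.d \ Ioc (-ρ) ρ, c.cosCoeff F r = 0 := fun r hr => by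
    simp [cosCoeff, (hout r hr).self_of_nhds]
  have hFc : ContinuousOn F (Icc (-ρ) ρ) := fun r hr =>
    (hF2 r (hI hr)).continuousAt.continuousWithinAt
  have hF'c : ContinuousOn (deriv F) (Icc (-ρ) ρ) := fun r hr =>
    (((hF2 r (hI hr)).fderiv_right (m := 1) (by norm_num)).clm_apply
      contDiffAt_const).continuousAt.continuousWithinAt
  have hc₁ : ContinuousOn c.c₁ (Icc (-ρ) ρ) := fun r hr =>
    (c.hasDerivAt_c₁ (hI hr)).continuousAt.continuousWithinAt
  have hc₁' : ContinuousOn (deriv c.c₁) (Icc (-ρ) ρ) := fun r hr =>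
    (c.hasDerivAt_deriv_c₁ (hI hr)).continuousAt.continuousWithinAt
  have hsinc : ContinuousOn (c.sinCoeff F) (Icc (-ρ) ρ) := by
    unfold sinCoeff
    fun_prop
  have hcosc : ContinuousOn (c.cosCoeff F) (Icc (-ρ) ρ) := by
    unfold cosCoeff
    fun_prop
  have hsinI : IntegrableOn (c.sinCoeff F) (Ioc (-ρ) ρ) :=
    hsinc.integrableOn_Icc.mono_set Ioc_subset_Icc_self
  have hcosI : IntegrableOn (c.cosCoeff F) (Ioc (-ρ) ρ) :=
    hcosc.integrableOn_Icc.mono_set Ioc_subset_Icc_self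
  have hsub : Ioc (-ρ) ρ ⊆ Ioo (-c.d) c.d := Ioc_subset_Icc_self.trans hI
  have htrig : ∀ f : ℝ → ℝ, Continuous f → IntegrableOn f (Ioo (-Real.pi) Real.pi) :=
    fun f hf => hf.integrableOn_Icc.mono_set Ioo_subset_Icc_self
  have hmeas : MeasurableSet
      {x : E2 | x 0 ∈ Ioo (-c.d) c.d ∧ x 1 ∈ Ioo (-Real.pi) Real.pi} :=
    ((EuclideanSpace.proj 0 : E2 →L[ℝ] ℝ).continuous.measurable measurableSet_Ioo).inter
      ((EuclideanSpace.proj 1 : E2 →L[ℝ] ℝ).continuous.measurable measurableSet_Ioo)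
  have hval : c.misiolekCurvature V (c.perturbation h) =
      Real.pi * ∫ r in -ρ..ρ, (c.sinCoeff F r + c.cosCoeff F r) := by
    rw [misiolekCurvature, setIntegral_congr_fun hmeas fun x hx =>
      c.misiolekIntegrand_perturbation hF hF2 hh hx.1,
      setIntegral_coordinates_mul_add (a := fun θ => Real.sin θ ^ 2) (b := fun θ => Real.cos θ ^ 2)
        (hsinI.of_forall_sdiff_eq_zero measurableSet_Ioo hsin0) (htrig _ (by fun_prop))
        (hcosI.of_forall_sdiff_eq_zero measurableSet_Ioo hcos0) (htrig _ (by fun_prop)),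
      setIntegral_sin_sq, setIntegral_cos_sq,
      setIntegral_eq_of_subset_of_forall_sdiff_eq_zero measurableSet_Ioo hsub hsin0,
      setIntegral_eq_of_subset_of_forall_sdiff_eq_zero measurableSet_Ioo hsub hcos0,
      intervalIntegral.integral_of_le hle, integral_add hsinI hcosI]
    ring
  rw [hval]
  exact mul_pos Real.pi_pos (c.integral_coeff_pos hc hF2 hρ hsupp hne)

end Curvature

end ProfileCurve

theorem mainTheorem4 (c : ProfileCurve)
    (hc : ∀ r ∈ Set.Ioo (-c.d) c.d, 1 < deriv c.c₁ r ^ 2 - c.c₁ r * iteratedDeriv 2 c.c₁ r)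
    (s : ℝ) (hs : 3 < s)
    (V : E3 → E3) (hV : V ∈ c.divFreeFields s)
    (F : ℝ → ℝ) (hF : c.IsZonalFlow F V)
    (hsupp : closure {p | p ∈ c.surface ∧ V p ≠ 0} ⊆ c.openSurface)
    (hne : ∃ p ∈ c.surface, V p ≠ 0) :
    ∃ h : ℝ → ℝ, ContDiff ℝ ∞ h ∧ HasCompactSupport h ∧ tsupport h ⊆ Set.Ioo (-c.d) c.d ∧
      (∀ r ∈ closure {r | r ∈ Set.Ioo (-c.d) c.d ∧ F r ≠ 0}, h r ≠ 0 ∧ deriv h r = 0) ∧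
      ∃ W₀ ∈ c.divFreeFields s,
        (∀ r ∈ Set.Ioo (-c.d) c.d, ∀ θ : ℝ,
          W₀ (c.param !₂[r, θ]) =
            (h r * Real.sin θ) • LocalParam.frame c.param 0 !₂[r, θ] +
            ((deriv h r + h r * deriv c.c₁ r / c.c₁ r) * Real.cos θ) •
              LocalParam.frame c.param 1 !₂[r, θ]) ∧
        0 < c.misiolekCurvature V W₀ := by
  obtain ⟨ρ, hρ, hball⟩ := c.exists_zonalSupport_subset_ball hF hsupp
  -- Equal to `1` on the ball containing the support of `F`; the outer radius is halfway from `ρ` to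
  -- `d`, so the support of `h` stays away from the poles.
  let h : ContDiffBump (0 : ℝ) := ⟨ρ, (ρ + c.d) / 2, hρ.1, by linarith [hρ.2]⟩
  have htsupp : tsupport h ⊆ Ioo (-c.d) c.d := by
    rw [h.tsupport_eq, Real.closedBall_eq_Icc]
    have : h.rOut < c.d := by
      simp only [h]
      linarith [hρ.2]
    exact Icc_subset_Ioo (by linarith) (by linarith)
  have hone : ∀ r ∈ c.zonalSupport F, h =ᶠ[nhds r] fun _ => 1 := fun r hr =>
    h.eventuallyEq_one_of_mem_ball (hball hr)
  refine ⟨h, h.contDiff, h.hasCompactSupport, htsupp, fun r hr => ?_, c.perturbation h,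
    c.perturbation_mem_divFreeFields h.contDiff htsupp s, fun r hr θ => ?_,
    c.misiolekCurvature_perturbation_pos hc hF (fun r hr => hF.contDiffAt hs hV hr) hρ hball
      (c.exists_ne_zero hF hsupp hne) hone⟩
  · have h1 := hone r hr
    refine ⟨?_, ?_⟩
    · rw [h1.self_of_nhds]
      exact one_ne_zero
    · rw [h1.deriv_eq, deriv_const]
  · rw [c.perturbation_param (y := !₂[r, θ]) hr, LocalParam.fderiv_apply_eq_frame]
    rfl
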